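/- **Setting.** Let $f:\mathbb{R}^p\to\mathbb{R}\cup\{+\infty\}$ be proper, closed and convex, let $A\in\mathbb{R}^{n\times p}$, $b\in\mathbb{R}^n$, and let $\mathcal{K}\subseteq\mathbb{R}^n$ be closed and convex with $0\in\mathcal{K}$. All norms are Euclidean (operator norm for $A$). Consider $$f^\star:=\min_{x\in\mathbb{R}^p}\{f(x)\ :\ Ax-b\in\mathcal{K}\}.$$ Assume that a solution exists and that Slater's condition $\operatorname{ri}(\operatorname{dom}f)\cap\{x: Ax-b\in\operatorname{ri}\mathcal{K}\}\neq\emptyset$ holds. Let $s_{\mathcal{K}}(y)=\sup_{u\in\mathcal{K}}\langle u,y\rangle$; the dual problem is $\min_{y}\{f^*(-A^\top y)+\langle b,y\rangle+s_{\mathcal{K}}(y)\}$, where $f^*$ is the Fenchel conjugate of $f$. Let $p_{\mathcal{Y}}:\mathbb{R}^n\to\mathbb{R}$ be differentiable and $1$-strongly convex with $L$-Lipschitz gradient, and let $b_{\mathcal{Y}}(y,\dot y)=p_{\mathcal{Y}}(y)-p_{\mathcal{Y}}(\dot y)-\langle\nabla p_{\mathcal{Y}}(\dot y),y-\dot y\rangle$.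 Let $\operatorname{dist}_{\mathcal{K}}$ be the Euclidean distance to $\mathcal{K}$. **Algorithm.** Let $\omega>1$, $\beta_0>0$, $m_0\in\mathbb{N}$ with $m_0>\frac1{\omega-1}$, $\bar x^0=\tilde x^0\in\mathbb{R}^p$, $\dot y^0\in\mathbb{R}^n$, and, for $s\ge 0$, $$m_{s+1}=\lfloor\omega(m_s+1)+1\rfloor-1,\qquad \beta_{s+1}=\frac{\beta_s(m_{s+1}+1)}{\omega\sqrt{m_{s+1}(m_{s+1}+3)}},\qquad K_0=0,\quad K_{s+1}=K_s+m_s .$$ For each stage $s\ge0$ and each $k=K_s,\dots,K_{s+1}-1$, with $\tau_k=\frac{2}{k-K_s+2}$, $$\begin{aligned} \tilde y^{k+1}&=\arg\max_{y\in\mathbb{R}^n}\{\langle A\tilde x^k-b,y\rangle-s_{\mathcal{K}}(y)-\beta_s b_{\mathcal{Y}}(y,\dot y^s)\},\\ \bar x^{k+1}&\in\arg\min_{x\in\mathbb{R}^p}\Big\{f(x)+\langle A^\top\tilde y^{k+1},x-\tilde x^k\rangle+\tfrac{\|A\|^2}{2\beta_s}\|x-\tilde x^k\|^2\Big\},\\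 \tilde x^{k+1}&=\bar x^{k+1}+\tfrac{(1-\tau_k)\tau_{k+1}}{\tau_k}(\bar x^{k+1}-\bar x^k), \end{aligned}$$ and at the end of stage $s$ $$\dot y^{s+1}=\arg\max_{y\in\mathbb{R}^n}\{\langle A\bar x^{K_{s+1}}-b,y\rangle-s_{\mathcal{K}}(y)-\beta_s b_{\mathcal{Y}}(y,\dot y^s)\}.$$ (Thus $\tau$ is reset to $1$ at $k=K_{s+1}$.) **Theorem.** Let $x^\star$ be any solution of the primal problem and $y^\star$ any solution of the dual problem, and set $$\rho_0=\beta_0\Big(1-\frac{1}{(\omega-1)m_0}\Big),\quad \kappa_0=m_0+\frac{\omega}{\omega-1},\quad R_0=\Big[\frac{4\|A\|^2}{(m_0+1)^2}\cdot\frac12\|x^\star-\bar x^0\|^2+\frac{\beta_0^2m_0(m_0+3)}{(m_0+1)^2}b_{\mathcal{Y}}(y^\star,\dot y^0)\Big]^{1/2}.$$ Then, for every $s\ge0$, $$\begin{aligned} f(\bar x^{K_{s+1}})-f^\star&\ge-\|y^\star\|\operatorname{dist}_{\mathcal{K}}(A\bar x^{K_{s+1}}-b)-\frac{2\sqrt2\,\omega\beta_0L\kappa_0\|y^\star\|R_0}{\rho_0[(\omega-1)K_{s+1}+\kappa_0]},\\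 f(\bar x^{K_{s+1}})-f^\star&\le\frac{\omega\kappa_0R_0^2}{\rho_0[(\omega-1)K_{s+1}+\kappa_0]}+\frac{\omega\beta_0L\kappa_0}{2[(\omega-1)K_{s+1}+\kappa_0]}\Big(\|y^\star\|+\frac{\sqrt2R_0}{\rho_0}\Big)^2,\\ \operatorname{dist}_{\mathcal{K}}(A\bar x^{K_{s+1}}-b)&\le\frac{\omega\beta_0L\kappa_0}{(\omega-1)K_{s+1}+\kappa_0}\Big[2\|y^\star\|+\Big(2\sqrt2+\sqrt{\tfrac{2}{L}}\Big)\frac{R_0}{\rho_0}\Big]. \end{aligned}$$ Consequently the algorithm converges at the non-ergodic rate $O(1/K_{s+1})$: there is a constant $C$, independent of $s$, such that $|f(\bar x^{K_{s+1}})-f^\star|\le C/K_{s+1}$ and $\operatorname{dist}_{\mathcal{K}}(A\bar x^{K_{s+1}}-b)\le C/K_{s+1}$ for all $s\ge0$. -/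

import Mathlib

open scoped NNReal

noncomputable section

/-- The space of real column vectors of length `d` with the Euclidean norm. -/
abbrev Vec (d : ℕ) : Type := EuclideanSpace ℝ (Fin d)

/-! ### Extended-real-valued convex functions -/

/-- Proper: nowhere equal to `-∞` and somewhere finite. -/
def IsProperFun {d : ℕ} (f : Vec d → EReal) : Prop :=
  (∀ x, f x ≠ ⊥) ∧ ∃ x, f x ≠ ⊤

/-- Convex: the epigraph is a convex set. -/
def IsConvexFun {d : ℕ} (f : Vec d → EReal) : Prop :=
  Convex ℝ {q : Vec d × ℝ | f q.1 ≤ (q.2 : EReal)}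

/-- The effective domain. -/
def effDomain {d : ℕ} (f : Vec d → EReal) : Set (Vec d) := {x | f x < ⊤}

/-- The Fenchel conjugate. -/
def fenchelConj {d : ℕ} (f : Vec d → EReal) (u : Vec d) : EReal :=
  ⨆ x : Vec d, ((inner ℝ x u : ℝ) : EReal) - f x

/-- The support function of a set. -/
def supportFun {d : ℕ} (K : Set (Vec d)) (y : Vec d) : EReal :=
  ⨆ u ∈ K, ((inner ℝ u y : ℝ) : EReal)

/-! ### The constrained problem -/

/-- The data of the problem of minimizing `f x` subject to `A x - b ∈ K`. -/
structure ConstrainedProblem (p n : ℕ) where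
  /-- the objective -/
  f : Vec p → EReal
  /-- the linear operator -/
  A : Vec p →L[ℝ] Vec n
  /-- the right-hand side -/
  b : Vec n
  /-- the constraint set -/
  K : Set (Vec n)

namespace ConstrainedProblem

variable {p n : ℕ} (P : ConstrainedProblem p n)

/-- The feasible set. -/
def feasible : Set (Vec p) := {x | P.A x - P.b ∈ P.K}

/-- The optimal value `f⋆`. -/
def optVal : EReal := ⨅ x ∈ P.feasible, P.f x

/-- Solutions of the primal problem. -/
def IsPrimalSolution (x : Vec p) : Prop :=
  x ∈ P.feasible ∧ ∀ z ∈ P.feasible, P.f x ≤ P.f z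

/-- The objective `f^*(-Aᵀ y) + ⟨b, y⟩ + s_K(y)` of the dual minimization problem. -/
def dualObj (y : Vec n) : EReal :=
  fenchelConj P.f (-(ContinuousLinearMap.adjoint P.A y)) + ((inner ℝ P.b y : ℝ) : EReal)
    + supportFun P.K y

/-- Solutions of the dual problem. -/
def IsDualSolution (y : Vec n) : Prop := ∀ z, P.dualObj y ≤ P.dualObj z

/-- The standing assumptions of the constrained case: there is a primal solution, the objective is
proper, closed and convex, the constraint set is closed, convex and contains the origin, and
Slater's condition (with relative interiors) holds. -/
structure StandingAssumptions : Prop where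
  exists_solution : ∃ x, P.IsPrimalSolution x
  proper : IsProperFun P.f
  closed : LowerSemicontinuous P.f
  convex : IsConvexFun P.f
  set_closed : IsClosed P.K
  set_convex : Convex ℝ P.K
  zero_mem : (0 : Vec n) ∈ P.K
  slater : (intrinsicInterior ℝ (effDomain P.f) ∩
    {x | P.A x - P.b ∈ intrinsicInterior ℝ P.K}).Nonempty

end ConstrainedProblem

/-! ### Bregman distances -/

/-- The Bregman distance induced by a differentiable function `h`. -/
def bregman {d : ℕ} (h : Vec d → ℝ) (y z : Vec d) : ℝ :=
  h y - h z - inner ℝ (gradient h z) (y - z)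

/-- `h` is a prox-function with strong convexity modulus `1` whose gradient (equivalently, the
gradient of its Bregman distance in the first variable) is Lipschitz with constant `L`. -/
structure IsProxFunction {d : ℕ} (h : Vec d → ℝ) (L : ℝ≥0) : Prop where
  differentiable : Differentiable ℝ h
  strongConvex : StrongConvexOn Set.univ 1 h
  lipschitz_gradient : LipschitzWith L (gradient h)

/-- The Euclidean distance-generating choice `(1/2) ‖u - v‖²` used in the primal space. -/
def halfSqDist {d : ℕ} (u v : Vec d) : ℝ := (1 / 2) * ‖u - v‖ ^ 2

/-! ### Parameters -/

/-- The numbers `m s` of inner iterations: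
`m (s + 1) = ⌊ω (m s + 1) + 1⌋ - 1`. -/
def innerCount (ω : ℝ) (m₀ : ℕ) : ℕ → ℕ
  | 0 => m₀
  | s + 1 => ⌊ω * ((innerCount ω m₀ s : ℝ) + 1) + 1⌋₊ - 1

/-- The smoothness parameters `β s`. -/
def smoothParam (ω β₀ : ℝ) (m₀ : ℕ) : ℕ → ℝ
  | 0 => β₀
  | s + 1 => smoothParam ω β₀ m₀ s * ((innerCount ω m₀ (s + 1) : ℝ) + 1) /
      (ω * Real.sqrt ((innerCount ω m₀ (s + 1) : ℝ) * ((innerCount ω m₀ (s + 1) : ℝ) + 3)))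

/-- The index `K s` of the first inner iteration of stage `s`:
`K 0 = 0` and `K (s + 1) = K s + m s`. -/
def restartIndex (ω : ℝ) (m₀ : ℕ) : ℕ → ℕ
  | 0 => 0
  | s + 1 => restartIndex ω m₀ s + innerCount ω m₀ s

/-! ### The two elementary steps -/

variable {p n : ℕ}

/-- `y` is a maximizer over the whole space of `⟨A x - b, y⟩ - s_K(y) - β b_Y(y, c)`. -/
def IsDualStep (P : ConstrainedProblem p n) (h : Vec n → ℝ) (β : ℝ) (x : Vec p) (c y : Vec n) :
    Prop :=
  IsMaxOn (fun z : Vec n =>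
    ((inner ℝ (P.A x - P.b) z - β * bregman h z c : ℝ) : EReal) - supportFun P.K z) Set.univ y

/-- `v` is a minimizer of `f(v) + ⟨w, v - u⟩ + (1/θ) d(v, u)` with `d(v, u) = ‖v - u‖² / 2`. -/
def IsProxStep (f : Vec p → EReal) (θ : ℝ) (u w v : Vec p) : Prop :=
  IsMinOn (fun z : Vec p =>
    f z + ((inner ℝ w (z - u) + 1 / θ * halfSqDist z u : ℝ) : EReal)) Set.univ v

/-! ### The double-loop algorithm -/

/-- The sequences `xbar`, `xtil`, `ytil`, `ydot`, `tau` are generated by the double-loop algorithm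
with accelerated proximal gradient (FISTA) inner steps, started at `x₀` and with dual center `y₀`.

Stage `s` consists of the iterations `k = K s + j`, `j < m s`, with the fixed smoothness parameter
`β s` and the fixed dual center `ydot s`. The parameter `tau` is reset to `1` at the beginning of
each stage. As `tau (K (s + 1)) = 1`, the extrapolation that closes stage `s` returns
`xtil (K (s + 1)) = xbar (k) + (1 / tau k) (xbar (k + 1) - xbar k)` for `k + 1 = K (s + 1)`,
the auxiliary FISTA iterate from which the next stage is restarted, and the first extrapolation of
the next stage has coefficient `0`, so that `xbar (K (s + 1))` is not used there any more. -/
structure IsDoubleLoopRun (P : ConstrainedProblem p n) (h : Vec n → ℝ) (ω β₀ : ℝ) (m₀ : ℕ)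
    (x₀ : Vec p) (y₀ : Vec n) (xbar xtil : ℕ → Vec p) (ytil ydot : ℕ → Vec n) (tau : ℕ → ℝ) :
    Prop where
  xbar_zero : xbar 0 = x₀
  xtil_zero : xtil 0 = x₀
  ydot_zero : ydot 0 = y₀
  tau_eq : ∀ s j, j < innerCount ω m₀ s → tau (restartIndex ω m₀ s + j) = 2 / ((j : ℝ) + 2)
  dual_step : ∀ s j, j < innerCount ω m₀ s →
    IsDualStep P h (smoothParam ω β₀ m₀ s) (xtil (restartIndex ω m₀ s + j)) (ydot s)
      (ytil (restartIndex ω m₀ s + j + 1))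
  prox_step : ∀ s j, j < innerCount ω m₀ s →
    IsProxStep P.f (smoothParam ω β₀ m₀ s / ‖P.A‖ ^ 2) (xtil (restartIndex ω m₀ s + j))
      (ContinuousLinearMap.adjoint P.A (ytil (restartIndex ω m₀ s + j + 1)))
      (xbar (restartIndex ω m₀ s + j + 1))
  extrapolation : ∀ k, xtil (k + 1) =
    xbar (k + 1) + ((1 - tau k) * tau (k + 1) / tau k) • (xbar (k + 1) - xbar k)
  center_step : ∀ s,
    IsDualStep P h (smoothParam ω β₀ m₀ s) (xbar (restartIndex ω m₀ (s + 1))) (ydot s)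
      (ydot (s + 1))

/-! ### The constants of the estimates -/

/-- `ρ₀ = β₀ (1 - 1 / ((ω - 1) m₀))`. -/
def rhoZero (ω β₀ : ℝ) (m₀ : ℕ) : ℝ := β₀ * (1 - 1 / ((ω - 1) * (m₀ : ℝ)))

/-- `κ₀ = m₀ + ω / (ω - 1)`. -/
def kappaZero (ω : ℝ) (m₀ : ℕ) : ℝ := (m₀ : ℝ) + ω / (ω - 1)

/-- `R₀`, for the primal solution `xs` and the dual solution `ys`. -/
def RZero (P : ConstrainedProblem p n) (h : Vec n → ℝ) (β₀ : ℝ) (m₀ : ℕ)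
    (x₀ : Vec p) (y₀ : Vec n) (xs : Vec p) (ys : Vec n) : ℝ :=
  Real.sqrt (4 * ‖P.A‖ ^ 2 / ((m₀ : ℝ) + 1) ^ 2 * halfSqDist xs x₀ +
    β₀ ^ 2 * (m₀ : ℝ) * ((m₀ : ℝ) + 3) / ((m₀ : ℝ) + 1) ^ 2 * bregman h ys y₀)

/-- `(ω - 1) K (s + 1) + κ₀`, the denominator of the estimates after stage `s`. -/
def rateDenom (ω : ℝ) (m₀ s : ℕ) : ℝ :=
  (ω - 1) * (restartIndex ω m₀ (s + 1) : ℝ) + kappaZero ω m₀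

end

/-!
The method is a restarted accelerated proximal gradient method for the objective in which the
constraint is replaced by the smoothed penalty
`max_y {⟨A x - b, y⟩ - s_K(y) - β b_Y(y, c)}`, whose gradient is Lipschitz with constant `‖A‖² / β`.

*One stage.* Put `G = (smoothed objective) - f⋆ + β b_Y(y⋆, c)`. The smoothed gap may be negative,
but `G ≥ 0` because `y⋆` is a Lagrange multiplier. So the usual telescoping of accelerated steps
applies to `G` (`accelerated_step`, `accelerated_stage`), at the price of the extra term
`β b_Y(y⋆, c) ∑ 1 / τ_j = β b_Y(y⋆, c) m (m + 3) / 4`. All estimates are kept for an arbitrary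
multiplier `y` (`smoothedLagrangian`), so the maximum over `y` is never formed.

*Restarts.* The three-point inequality for the new center gives `G ≥ β b_Y(y⋆, ydot (s + 1))`, and
the closing extrapolation returns the auxiliary iterate of the accelerated method. The parameters
`m s`, `β s` are tuned so that the energy `stageEnergy`, made of the distances of the auxiliary
iterate and of the center to the solutions, shrinks by `ω²` per stage
(`IsDoubleLoopRun.stageEnergy_succ_le`). As `β s` is of order `ω⁻ˢ`, both centers of a stage stay
within `√2 R₀ / ρ₀` of `y⋆`, and `ω⁻ˢ` is at most `ω κ₀ / ((ω - 1) K (s + 1) + κ₀)`.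

*Conclusion.* The multiplier `y = 0` gives the upper bound on the objective, the Lagrangian at `y⋆`
gives the lower bound, and the optimality condition of the center step produces a point of `K` close
to `A x - b`.

*Duality.* That a dual solution is a Lagrange multiplier, and that one exists, is strong duality
under Slater's condition with relative interiors (`ConstrainedProblem.IsDualSolution.le_lagrangian`).
It is derived from the Riesz extension theorem for cones: Slater's condition puts `0` in the relative
algebraic interior of the domain of the value function (`exists_multiplier_of_convex`).
-/

open Set Filter Topology

/-! ### First-order conditions for convex functions -/

/-- The term `t ^ 2 * e` of second order does not affect the derivative; it carries the modulus of
strong convexity in `IsProxFunction.half_sq_le_bregman`. -/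
theorem HasDerivAt.le_of_forall_sub_le {φ : ℝ → ℝ} {φ' c e : ℝ} (hφ : HasDerivAt φ φ' 0)
    (hstep : ∀ t ∈ Ioo (0 : ℝ) 1, φ t - φ 0 ≤ t * (c + t * e)) : φ' ≤ c := by
  have h1 : Tendsto (fun t : ℝ => t⁻¹ • (φ (0 + t) - φ 0)) (𝓝[>] 0) (𝓝 φ') :=
    hφ.tendsto_slope_zero_right
  have h2 : Tendsto (fun t : ℝ => c + t * e) (𝓝[>] 0) (𝓝 c) := by
    have : Tendsto (fun t : ℝ => c + t * e) (𝓝 0) (𝓝 (c + 0 * e)) :=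
      (by fun_prop : Continuous fun t : ℝ => c + t * e).tendsto 0
    rw [zero_mul, add_zero] at this
    exact this.mono_left nhdsWithin_le_nhds
  refine le_of_tendsto_of_tendsto h1 h2 ?_
  filter_upwards [Ioo_mem_nhdsGT (zero_lt_one' ℝ)] with t ht
  rw [zero_add, smul_eq_mul, inv_mul_le_iff₀ ht.1]
  exact hstep t ht

/-- Fermat's rule for a sum of a convex function `σ` and a function `q` differentiable along a
segment; `φ` is `q` on the segment from the minimizer `y₀` to `y`. -/
theorem ConvexOn.fermat_rule {E : Type*} [AddCommGroup E] [Module ℝ E] {D : Set E} {σ : E → ℝ}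
    (hσ : ConvexOn ℝ D σ) {y₀ y : E} (h₀ : y₀ ∈ D) (hy : y ∈ D) {φ : ℝ → ℝ} {φ' : ℝ}
    (hφ : HasDerivAt φ φ' 0)
    (hmin : ∀ t ∈ Ioo (0 : ℝ) 1, y₀ + t • (y - y₀) ∈ D →
      σ y₀ + φ 0 ≤ σ (y₀ + t • (y - y₀)) + φ t) :
    0 ≤ σ y - σ y₀ + φ' := by
  have key : -φ' ≤ σ y - σ y₀ := by
    refine HasDerivAt.le_of_forall_sub_le (φ := fun t => -φ t) (e := 0) hφ.neg ?_
    intro t ht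
    have e1 : y₀ + t • (y - y₀) = (1 - t) • y₀ + t • y := by
      rw [smul_sub, sub_smul, one_smul]; abel
    have hmem : (1 - t) • y₀ + t • y ∈ D :=
      hσ.1 h₀ hy (by linarith [ht.2]) ht.1.le (by ring)
    have h1 := hmin t ht (e1 ▸ hmem)
    have h2 := hσ.2 h₀ hy (sub_nonneg.2 ht.2.le) ht.1.le (sub_add_cancel 1 t)
    rw [e1] at h1
    simp only [smul_eq_mul] at h2
    linarith
  linarith

section Line

variable {E : Type*} [NormedAddCommGroup E] [InnerProductSpace ℝ E] [CompleteSpace E]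

theorem HasGradientAt.hasDerivAt_line {h : E → ℝ} {g z d : E} {t : ℝ}
    (hg : HasGradientAt h g (z + t • d)) :
    HasDerivAt (fun t : ℝ => h (z + t • d)) (inner ℝ g d) t := by
  have h1 : HasDerivAt (fun t : ℝ => z + t • d) d t := by
    simpa using ((hasDerivAt_id t).smul_const d).const_add z
  exact (hg.hasFDerivAt.comp_hasDerivAt t h1).congr_deriv (by simp)

end Line

/-! ### Bregman distances -/

section Bregman

variable {d : ℕ} {h : Vec d → ℝ} {L : ℝ≥0}

theorem bregman_three_point (y z c : Vec d) :
    bregman h y c = bregman h z c + bregman h y z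
      + inner ℝ (gradient h z - gradient h c) (y - z) := by
  simp only [bregman, inner_sub_left, inner_sub_right]
  ring

theorem IsProxFunction.half_sq_le_bregman (hh : IsProxFunction h L) (y z : Vec d) :
    1 / 2 * ‖y - z‖ ^ 2 ≤ bregman h y z := by
  have hd : HasDerivAt (fun t : ℝ => h (z + t • (y - z))) (inner ℝ (gradient h z) (y - z)) 0 := by
    refine HasGradientAt.hasDerivAt_line ?_
    simpa using (hh.differentiable z).hasGradientAt
  have := hd.le_of_forall_sub_le (c := h y - h z - 1 / 2 * ‖y - z‖ ^ 2)
    (e := 1 / 2 * ‖y - z‖ ^ 2) ?_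
  · unfold bregman; linarith
  intro t ht
  have h2 := hh.strongConvex.2 (mem_univ z) (mem_univ y) (sub_nonneg.2 ht.2.le) ht.1.le
    (sub_add_cancel 1 t)
  have e1 : z + t • (y - z) = (1 - t) • z + t • y := by
    rw [smul_sub, sub_smul, one_smul]; abel
  simp only [smul_eq_mul, norm_sub_rev z y] at h2
  simp only [e1, zero_smul, add_zero]
  linarith

theorem IsProxFunction.bregman_nonneg (hh : IsProxFunction h L) (y z : Vec d) :
    0 ≤ bregman h y z :=
  le_trans (by positivity) (hh.half_sq_le_bregman y z)

/-- The descent lemma. -/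
theorem IsProxFunction.bregman_le (hh : IsProxFunction h L) (y z : Vec d) :
    bregman h y z ≤ L / 2 * ‖y - z‖ ^ 2 := by
  set φ : ℝ → ℝ := fun t =>
    h (z + t • (y - z)) - t * inner ℝ (gradient h z) (y - z) - L / 2 * ‖y - z‖ ^ 2 * t ^ 2 with hφ
  have hd : ∀ t : ℝ, HasDerivAt φ (inner ℝ (gradient h (z + t • (y - z))) (y - z)
      - inner ℝ (gradient h z) (y - z) - L * ‖y - z‖ ^ 2 * t) t := by
    intro t
    have h1 := HasGradientAt.hasDerivAt_line (hh.differentiable (z + t • (y - z))).hasGradientAt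
    have h2 := (hasDerivAt_id t).mul_const (inner ℝ (gradient h z) (y - z))
    have h3 := ((hasDerivAt_id t).pow 2).const_mul (L / 2 * ‖y - z‖ ^ 2)
    refine ((h1.sub h2).sub h3).congr_deriv ?_
    simp only [id, Nat.cast_ofNat]
    ring
  have hanti : AntitoneOn φ (Icc 0 1) := by
    refine antitoneOn_of_deriv_nonpos (convex_Icc 0 1)
      (fun t _ => (hd t).continuousAt.continuousWithinAt)
      (fun t _ => (hd t).differentiableAt.differentiableWithinAt) ?_
    intro t ht
    rw [interior_Icc] at ht
    rw [(hd t).deriv, ← inner_sub_left]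
    have h1 := real_inner_le_norm (gradient h (z + t • (y - z)) - gradient h z) (y - z)
    have h2 := hh.lipschitz_gradient.norm_sub_le (z + t • (y - z)) z
    rw [add_sub_cancel_left, norm_smul, Real.norm_of_nonneg ht.1.le] at h2
    have h3 := mul_le_mul_of_nonneg_right h2 (norm_nonneg (y - z))
    linarith
  have := hanti (left_mem_Icc.2 zero_le_one) (right_mem_Icc.2 zero_le_one) zero_le_one
  simp only [hφ, one_smul, add_sub_cancel, zero_smul, add_zero] at this
  unfold bregman
  linarith

theorem IsProxFunction.norm_sub_le (hh : IsProxFunction h L) {y z : Vec d} {r : ℝ} (hr : 0 ≤ r)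
    (hb : bregman h y z ≤ r ^ 2) : ‖y - z‖ ≤ Real.sqrt 2 * r := by
  refine abs_le_of_sq_le_sq' ?_ (by positivity) |>.2
  rw [mul_pow, Real.sq_sqrt zero_le_two]
  linarith [hh.half_sq_le_bregman y z]

end Bregman

/-! ### Finite values of extended-real-valued functions -/

section EffDomain

variable {d : ℕ} {f : Vec d → EReal}

theorem IsProperFun.coe_toReal (hf : IsProperFun f) {x : Vec d} (hx : x ∈ effDomain f) :
    ((f x).toReal : EReal) = f x :=
  EReal.coe_toReal (ne_of_lt hx) (hf.1 x)

theorem IsConvexFun.convexOn_toReal (hc : IsConvexFun f) (hf : IsProperFun f) :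
    ConvexOn ℝ (effDomain f) (fun x => (f x).toReal) := by
  have key : ∀ x ∈ effDomain f, ∀ y ∈ effDomain f, ∀ a b : ℝ, 0 ≤ a → 0 ≤ b → a + b = 1 →
      f (a • x + b • y) ≤ ((a * (f x).toReal + b * (f y).toReal : ℝ) : EReal) := by
    intro x hx y hy a b ha hb hab
    have := hc (x := (x, (f x).toReal)) (hf.coe_toReal hx).ge
      (y := (y, (f y).toReal)) (hf.coe_toReal hy).ge ha hb hab
    simpa using this
  refine ⟨fun x hx y hy a b ha hb hab =>
    (key x hx y hy a b ha hb hab).trans_lt (EReal.coe_lt_top _), ?_⟩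
  intro x hx y hy a b ha hb hab
  have h1 := key x hx y hy a b ha hb hab
  have h2 := EReal.toReal_le_toReal h1 (hf.1 _) (EReal.coe_ne_top _)
  rwa [EReal.toReal_coe] at h2

end EffDomain

/-! ### Support functions -/

section Support

variable {d : ℕ} {K : Set (Vec d)}

theorem supportFun_ne_bot (h0 : (0 : Vec d) ∈ K) (y : Vec d) : supportFun K y ≠ ⊥ := by
  have : ((inner ℝ (0 : Vec d) y : ℝ) : EReal) ≤ supportFun K y :=
    le_iSup₂ (f := fun (u : Vec d) (_ : u ∈ K) => ((inner ℝ u y : ℝ) : EReal)) 0 h0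
  exact ne_of_gt (lt_of_lt_of_le (EReal.bot_lt_coe _) this)

theorem inner_le_toReal_supportFun {y u : Vec d} (hy : y ∈ effDomain (supportFun K))
    (hu : u ∈ K) : inner ℝ u y ≤ (supportFun K y).toReal := by
  have h1 : ((inner ℝ u y : ℝ) : EReal) ≤ supportFun K y :=
    le_iSup₂ (f := fun (u : Vec d) (_ : u ∈ K) => ((inner ℝ u y : ℝ) : EReal)) u hu
  simpa using EReal.toReal_le_toReal h1 (EReal.coe_ne_bot _) (ne_of_lt hy)

theorem supportFun_le_coe {y : Vec d} {c : ℝ} (h : ∀ u ∈ K, inner ℝ u y ≤ c) :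
    supportFun K y ≤ c :=
  iSup₂_le fun u hu => EReal.coe_le_coe_iff.2 (h u hu)

theorem mem_effDomain_supportFun {y : Vec d} {c : ℝ} (h : ∀ u ∈ K, inner ℝ u y ≤ c) :
    y ∈ effDomain (supportFun K) :=
  (supportFun_le_coe h).trans_lt (EReal.coe_lt_top _)

theorem toReal_supportFun_le (h0 : (0 : Vec d) ∈ K) {y : Vec d} {c : ℝ}
    (h : ∀ u ∈ K, inner ℝ u y ≤ c) : (supportFun K y).toReal ≤ c := by
  simpa using EReal.toReal_le_toReal (supportFun_le_coe h) (supportFun_ne_bot h0 y)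
    (EReal.coe_ne_top _)

theorem zero_mem_effDomain_supportFun : (0 : Vec d) ∈ effDomain (supportFun K) :=
  mem_effDomain_supportFun (c := 0) (by simp)

theorem toReal_supportFun_zero_le (h0 : (0 : Vec d) ∈ K) :
    (supportFun K (0 : Vec d)).toReal ≤ 0 :=
  toReal_supportFun_le h0 (by simp)

theorem convexOn_toReal_supportFun (h0 : (0 : Vec d) ∈ K) :
    ConvexOn ℝ (effDomain (supportFun K)) (fun y => (supportFun K y).toReal) := by
  have key : ∀ x ∈ effDomain (supportFun K), ∀ y ∈ effDomain (supportFun K), ∀ a b : ℝ,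
      0 ≤ a → 0 ≤ b → ∀ u ∈ K, inner ℝ u (a • x + b • y) ≤
        a * (supportFun K x).toReal + b * (supportFun K y).toReal := by
    intro x hx y hy a b ha hb u hu
    rw [inner_add_right, inner_smul_right, inner_smul_right]
    have h1 := mul_le_mul_of_nonneg_left (inner_le_toReal_supportFun hx hu) ha
    have h2 := mul_le_mul_of_nonneg_left (inner_le_toReal_supportFun hy hu) hb
    linarith
  exact ⟨fun x hx y hy a b ha hb _ => mem_effDomain_supportFun (key x hx y hy a b ha hb),
    fun x hx y hy a b ha hb _ => toReal_supportFun_le h0 (key x hx y hy a b ha hb)⟩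

/-- A subgradient of the support function of a closed convex set lies in the set. -/
theorem mem_of_subgradient_supportFun (h0 : (0 : Vec d) ∈ K) (hcl : IsClosed K)
    (hcv : Convex ℝ K) {v y : Vec d} (hy : y ∈ effDomain (supportFun K))
    (hv : ∀ z ∈ effDomain (supportFun K),
      (supportFun K y).toReal + inner ℝ v (z - y) ≤ (supportFun K z).toReal) : v ∈ K := by
  by_contra hvK
  obtain ⟨l, c, hl, hc⟩ := geometric_hahn_banach_closed_point hcv hcl hvK
  set w := (InnerProductSpace.toDual ℝ (Vec d)).symm l with hw
  have hlw : ∀ x, l x = inner ℝ x w := fun x => by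
    rw [real_inner_comm, hw, InnerProductSpace.toDual_symm_apply]
  have hwc : ∀ u ∈ K, inner ℝ u w ≤ c := fun u hu => (hlw u) ▸ (hl u hu).le
  -- By subadditivity, testing with `y + w` bounds `⟪v, w⟫` by the support function at `w`.
  have hyw : ∀ u ∈ K, inner ℝ u (y + w) ≤ (supportFun K y).toReal + c := fun u hu => by
    rw [inner_add_right]
    exact add_le_add (inner_le_toReal_supportFun hy hu) (hwc u hu)
  have h1 := hv (y + w) (mem_effDomain_supportFun hyw)
  have h2 := toReal_supportFun_le h0 hyw
  rw [add_sub_cancel_left] at h1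
  rw [hlw] at hc
  linarith

/-- `⟪u, y⟫ - s_K(y)` is at most `‖y‖` times the distance from `u` to `K`. -/
theorem inner_sub_supportFun_le (h0 : (0 : Vec d) ∈ K) {y : Vec d}
    (hy : y ∈ effDomain (supportFun K)) (u : Vec d) :
    inner ℝ u y - (supportFun K y).toReal ≤ ‖y‖ * Metric.infDist u K := by
  rcases eq_or_lt_of_le (norm_nonneg y) with hn | hn
  · have : y = 0 := norm_eq_zero.1 hn.symm
    subst this
    have := inner_le_toReal_supportFun hy h0
    simp at this ⊢
    linarith
  · have hne : K.Nonempty := ⟨0, h0⟩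
    have : (inner ℝ u y - (supportFun K y).toReal) / ‖y‖ ≤ Metric.infDist u K := by
      refine (Metric.le_infDist hne).2 fun v hv => ?_
      rw [div_le_iff₀ hn, dist_eq_norm]
      have h1 := inner_le_toReal_supportFun hy hv
      have h2 := real_inner_le_norm (u - v) y
      rw [inner_sub_left] at h2
      linarith
    rw [div_le_iff₀ hn] at this
    linarith

end Support

/-! ### The two elementary steps -/

section Steps

variable {p n : ℕ}

theorem IsProxStep.mem_effDomain {f : Vec p → EReal} (hf : IsProperFun f) {θ : ℝ} {u w v : Vec p}
    (hs : IsProxStep f θ u w v) : v ∈ effDomain f := by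
  obtain ⟨x, hx⟩ := hf.2
  have h1 := hs (mem_univ x)
  simp only [mem_ofPred_eq] at h1
  by_contra hv
  have hv' : f v = ⊤ := by simpa [effDomain] using hv
  rw [hv', EReal.top_add_coe, top_le_iff] at h1
  exact (EReal.add_lt_top hx (EReal.coe_ne_top _)).ne h1

theorem IsProxStep.three_point {f : Vec p → EReal} (hf : IsProperFun f) (hc : IsConvexFun f)
    {θ : ℝ} {u w v : Vec p} (hs : IsProxStep f θ u w v) {x : Vec p} (hx : x ∈ effDomain f) :
    (f v).toReal + inner ℝ w (v - u) + 1 / θ * halfSqDist v u + 1 / θ * halfSqDist x v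
      ≤ (f x).toReal + inner ℝ w (x - u) + 1 / θ * halfSqDist x u := by
  have hv := hs.mem_effDomain hf
  set q : Vec p → ℝ := fun z => inner ℝ w (z - u) + 1 / θ * halfSqDist z u with hq
  have hmin : ∀ z ∈ effDomain f, (f v).toReal + q v ≤ (f z).toReal + q z := by
    intro z hz
    have h1 := hs (mem_univ z)
    simp only [mem_ofPred_eq] at h1
    rw [← hf.coe_toReal hv, ← hf.coe_toReal hz, ← EReal.coe_add, ← EReal.coe_add,
      EReal.coe_le_coe_iff] at h1
    exact h1
  have hline : ∀ t : ℝ, q (v + t • (x - v)) = q v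
      + t * (inner ℝ w (x - v) + 1 / θ * inner ℝ (v - u) (x - v))
      + t ^ 2 * (1 / θ * halfSqDist x v) := by
    intro t
    have e : v + t • (x - v) - u = (v - u) + t • (x - v) := by abel
    simp only [hq, halfSqDist, e, norm_add_sq_real, inner_add_right, inner_smul_right, norm_smul,
      mul_pow, Real.norm_eq_abs, sq_abs]
    ring
  have hd : HasDerivAt (fun t : ℝ => q (v + t • (x - v)))
      (inner ℝ w (x - v) + 1 / θ * inner ℝ (v - u) (x - v)) 0 := by
    simp only [hline]
    have h2 := (((hasDerivAt_id (0 : ℝ)).mul_const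
      (inner ℝ w (x - v) + 1 / θ * inner ℝ (v - u) (x - v))).const_add (q v)).add
      (((hasDerivAt_id (0 : ℝ)).pow 2).mul_const (1 / θ * halfSqDist x v))
    refine h2.congr_deriv ?_
    simp
  have key := (hc.convexOn_toReal hf).fermat_rule hv hx hd (fun t _ hmem => by
    simpa using hmin _ hmem)
  have h1 := hline 1
  rw [one_smul, add_sub_cancel] at h1
  simp only [hq] at h1
  linarith

theorem IsDualStep.mem_effDomain {P : ConstrainedProblem p n} (h0 : (0 : Vec n) ∈ P.K)
    {h : Vec n → ℝ} {β : ℝ} {x : Vec p} {c y : Vec n} (hs : IsDualStep P h β x c y) :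
    y ∈ effDomain (supportFun P.K) := by
  by_contra hy
  have hy' : supportFun P.K y = ⊤ := by simpa [effDomain] using hy
  have h1 := hs (mem_univ 0)
  simp only [mem_ofPred_eq] at h1
  rw [hy', EReal.sub_top, le_bot_iff] at h1
  have h2 := supportFun_le_coe (K := P.K) (y := 0) (c := 0) (by simp)
  have h3 : ((supportFun P.K 0).toReal : EReal) = supportFun P.K 0 :=
    EReal.coe_toReal (ne_of_lt zero_mem_effDomain_supportFun) (supportFun_ne_bot h0 0)
  rw [← h3, ← EReal.coe_sub] at h1
  exact EReal.coe_ne_bot _ h1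

/-- The optimality condition of the dual step: `A x - b - β (∇h(y) - ∇h(c))` is a subgradient of
the support function at `y`. -/
theorem IsDualStep.subgradient {P : ConstrainedProblem p n} (h0 : (0 : Vec n) ∈ P.K)
    {h : Vec n → ℝ} (hh : Differentiable ℝ h) {β : ℝ} {x : Vec p} {c y : Vec n}
    (hs : IsDualStep P h β x c y) {z : Vec n} (hz : z ∈ effDomain (supportFun P.K)) :
    (supportFun P.K y).toReal
      + inner ℝ (P.A x - P.b - β • (gradient h y - gradient h c)) (z - y)
      ≤ (supportFun P.K z).toReal := by
  have hy := hs.mem_effDomain h0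
  set q : Vec n → ℝ := fun z => -(inner ℝ (P.A x - P.b) z - β * bregman h z c) with hq
  have hmin : ∀ z ∈ effDomain (supportFun P.K),
      (supportFun P.K y).toReal + q y ≤ (supportFun P.K z).toReal + q z := by
    intro z hz
    have h1 := hs (mem_univ z)
    simp only [mem_ofPred_eq] at h1
    rw [← EReal.coe_toReal (ne_of_lt hy) (supportFun_ne_bot h0 y),
      ← EReal.coe_toReal (ne_of_lt hz) (supportFun_ne_bot h0 z), ← EReal.coe_sub,
      ← EReal.coe_sub, EReal.coe_le_coe_iff] at h1
    simp only [hq]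
    linarith
  have hd : HasDerivAt (fun t : ℝ => q (y + t • (z - y)))
      (-(inner ℝ (P.A x - P.b) (z - y) - β * inner ℝ (gradient h y - gradient h c) (z - y))) 0 := by
    have hg : HasGradientAt h (gradient h y) (y + (0 : ℝ) • (z - y)) := by
      simpa using (hh y).hasGradientAt
    have h1 := (hg.hasDerivAt_line).const_mul β
    have h2 := (hasDerivAt_id (0 : ℝ)).mul_const (inner ℝ (P.A x - P.b) (z - y)
      + β * inner ℝ (gradient h c) (z - y))
    have h3 := (h1.sub h2).const_add
      (-inner ℝ (P.A x - P.b) y - β * h c - β * inner ℝ (gradient h c) (y - c))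
    refine (h3.congr_of_eventuallyEq (Eventually.of_forall fun t => ?_)).congr_deriv ?_
    · have e : y + t • (z - y) - c = (y - c) + t • (z - y) := by abel
      simp only [hq, bregman, e, inner_add_right, inner_smul_right, Pi.sub_apply, id]
      ring
    · rw [inner_sub_left (gradient h y)]; ring
  have key := (convexOn_toReal_supportFun h0).fermat_rule hy hz hd (fun t _ hmem => by
    simpa using hmin _ hmem)
  rw [inner_sub_left, inner_smul_left]
  simp only [conj_trivial]
  linarith

theorem IsDualStep.three_point {P : ConstrainedProblem p n} (h0 : (0 : Vec n) ∈ P.K)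
    {h : Vec n → ℝ} (hh : Differentiable ℝ h) {β : ℝ} {x : Vec p} {c y : Vec n}
    (hs : IsDualStep P h β x c y) {z : Vec n} (hz : z ∈ effDomain (supportFun P.K)) :
    inner ℝ (P.A x - P.b) z - (supportFun P.K z).toReal - β * bregman h z c + β * bregman h z y
      ≤ inner ℝ (P.A x - P.b) y - (supportFun P.K y).toReal - β * bregman h y c := by
  have h1 := hs.subgradient h0 hh hz
  have h2 := bregman_three_point (h := h) z y c
  rw [inner_sub_left, inner_smul_left] at h1
  simp only [conj_trivial, inner_sub_right (P.A x - P.b) z y] at h1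
  rw [h2]
  linarith

theorem IsDualStep.infDist_le {P : ConstrainedProblem p n} (h0 : (0 : Vec n) ∈ P.K)
    (hcl : IsClosed P.K) (hcv : Convex ℝ P.K)
    {h : Vec n → ℝ} (hh : Differentiable ℝ h) {β : ℝ} (hβ : 0 ≤ β) {x : Vec p} {c y : Vec n}
    (hs : IsDualStep P h β x c y) :
    Metric.infDist (P.A x - P.b) P.K ≤ β * ‖gradient h y - gradient h c‖ := by
  have hmem := mem_of_subgradient_supportFun h0 hcl hcv (hs.mem_effDomain h0)
    (fun z hz => hs.subgradient h0 hh hz)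
  refine (Metric.infDist_le_dist_of_mem hmem).trans (le_of_eq ?_)
  rw [dist_eq_norm, sub_sub_cancel, norm_smul, Real.norm_of_nonneg hβ]

end Steps

/-! ### Strong duality under Slater's condition -/

/-- Lagrange multipliers from the relative algebraic interior. `V` plays the role of the epigraph
of the value function `w ↦ inf {r | (w, r) ∈ V}`, whose value at `0` is `a`; `hcore` says that `0`
is in the relative algebraic interior of its domain, and `-y` is a subgradient at `0`.

The domain need not span `W`, so the cone to which the Riesz extension theorem is applied is pulled
back along the orthogonal projection onto the span of the domain. -/
theorem exists_multiplier_of_convex {W : Type*} [NormedAddCommGroup W] [InnerProductSpace ℝ W]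
    [FiniteDimensional ℝ W] {V : Set (W × ℝ)} {a : ℝ} (hV : Convex ℝ V) (h0 : (0, a) ∈ V)
    (hmin : ∀ r, ((0 : W), r) ∈ V → a ≤ r)
    (hcore : ∀ q ∈ V, ∃ ε : ℝ, 0 < ε ∧ ∃ r, (-(ε • q.1), r) ∈ V) :
    ∃ y : W, ∀ q ∈ V, a ≤ q.2 + inner ℝ q.1 y := by
  have hcomb : ∀ q ∈ V, ∀ q' ∈ V, ∀ t t' : ℝ, 0 < t → 0 < t' → ∃ q'' ∈ V,
      (t + t') • q'' = t • q + t' • q' := by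
    intro q hq q' hq' t t' ht ht'
    have hs : 0 < t + t' := by positivity
    refine ⟨(t / (t + t')) • q + (t' / (t + t')) • q', hV hq hq' (by positivity) (by positivity)
      (by field_simp), ?_⟩
    rw [smul_add, smul_smul, smul_smul, mul_div_cancel₀ _ hs.ne', mul_div_cancel₀ _ hs.ne']
  let S : Submodule ℝ W :=
    { carrier := {w | ∃ t : ℝ, 0 < t ∧ ∃ q ∈ V, w = t • q.1}
      zero_mem' := ⟨1, one_pos, (0, a), h0, by simp⟩
      add_mem' := by
        rintro _ _ ⟨t, ht, q, hq, rfl⟩ ⟨t', ht', q', hq', rfl⟩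
        obtain ⟨q'', hq'', he⟩ := hcomb q hq q' hq' t t' ht ht'
        exact ⟨t + t', by positivity, q'', hq'', (congrArg Prod.fst he).symm⟩
      smul_mem' := by
        rintro c _ ⟨t, ht, q, hq, rfl⟩
        rcases lt_trichotomy c 0 with hc | rfl | hc
        · obtain ⟨ε, hε, r, hr⟩ := hcore q hq
          refine ⟨-c * t / ε, by have := neg_pos.2 hc; positivity, _, hr, ?_⟩
          rw [smul_neg, smul_smul, smul_smul, div_mul_cancel₀ _ hε.ne', ← neg_smul]
          congr 1
          ring
        · exact ⟨1, one_pos, (0, a), h0, by simp⟩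
        · exact ⟨c * t, by positivity, q, hq, by rw [smul_smul]⟩ }
  have hVS : ∀ q ∈ V, q.1 ∈ S := fun q hq => ⟨1, one_pos, q, hq, by simp⟩
  let s : PointedCone ℝ (W × ℝ) :=
    { carrier := {z | ∃ t : ℝ, 0 < t ∧ ∃ q ∈ V, S.starProjection z.1 = t • q.1 ∧
        t * (q.2 - a) ≤ z.2}
      zero_mem' := ⟨1, one_pos, (0, a), h0, by simp⟩
      add_mem' := by
        rintro z z' ⟨t, ht, q, hq, h1, h2⟩ ⟨t', ht', q', hq', h1', h2'⟩
        obtain ⟨q'', hq'', he⟩ := hcomb q hq q' hq' t t' ht ht'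
        refine ⟨t + t', by positivity, q'', hq'', ?_, ?_⟩
        · rw [Prod.fst_add, map_add, h1, h1']
          exact (congrArg Prod.fst he).symm
        · have := congrArg Prod.snd he
          simp only [Prod.smul_snd, Prod.snd_add, smul_eq_mul] at this ⊢
          linarith
      smul_mem' := by
        rintro ⟨c, hc⟩ z ⟨t, ht, q, hq, h1, h2⟩
        rcases eq_or_lt_of_le hc with rfl | hc'
        · refine ⟨1, one_pos, (0, a), h0, ?_⟩
          have : (⟨0, hc⟩ : {c : ℝ // 0 ≤ c}) • z = 0 := by
            rw [← zero_smul ℝ z]; rfl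
          rw [this]
          simp
        · refine ⟨c * t, by positivity, q, hq, ?_, ?_⟩
          · change S.starProjection (c • z.1) = _
            rw [map_smul, h1, smul_smul]
          · change _ ≤ c * z.2
            rw [mul_assoc]
            exact mul_le_mul_of_nonneg_left h2 hc }
  let f : (W × ℝ) →ₗ.[ℝ] ℝ :=
    { domain := Submodule.prod ⊥ ⊤
      toFun := (LinearMap.snd ℝ W ℝ).comp (Submodule.subtype _) }
  obtain ⟨g, hgf, hgs⟩ := riesz_extension s f
    (by
      rintro ⟨⟨w, r⟩, hw⟩ ⟨t, ht, q, hq, h1, h2⟩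
      have hw0 : w = 0 := by simpa [f] using hw
      subst hw0
      change 0 ≤ r
      simp only [map_zero] at h1
      have hq0 : q.1 = 0 := (smul_eq_zero.1 h1.symm).resolve_left ht.ne'
      have h3 := hmin q.2 (by rw [← hq0]; exact hq)
      have := mul_nonneg ht.le (sub_nonneg.2 h3)
      exact this.trans h2)
    (by
      rintro ⟨w, r⟩
      obtain ⟨t, ht, q, hq, h1⟩ : S.starProjection w ∈ S := S.starProjection_apply_mem w
      refine ⟨⟨(0, t * (q.2 - a) - r), by simp [f]⟩, t, ht, q, hq, ?_, ?_⟩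
      · simpa using h1
      · simp)
  have hg0 : ∀ r : ℝ, g (0, r) = r := fun r => hgf ⟨(0, r), by simp [f]⟩
  refine ⟨(InnerProductSpace.toDual ℝ W).symm
    (LinearMap.toContinuousLinearMap (g.comp (LinearMap.inl ℝ W ℝ))), fun q hq => ?_⟩
  have h1 : 0 ≤ g (q.1, q.2 - a) := hgs _ ⟨1, one_pos, q, hq, by
    rw [Submodule.starProjection_eq_self_iff.2 (hVS q hq), one_smul], by simp⟩
  have h2 : ((q.1, q.2 - a) : W × ℝ) = (q.1, 0) + (0, q.2 - a) := by simp
  rw [h2, map_add, hg0] at h1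
  rw [real_inner_comm, InnerProductSpace.toDual_symm_apply]
  simp only [LinearMap.coe_toContinuousLinearMap', LinearMap.comp_apply, LinearMap.inl_apply]
  linarith

/-- A segment ending at a relative interior point can be prolonged slightly within the set. -/
theorem eventually_sub_smul_mem_of_mem_intrinsicInterior {E : Type*} [NormedAddCommGroup E]
    [NormedSpace ℝ E] {C : Set E} {x₀ x : E} (h₀ : x₀ ∈ intrinsicInterior ℝ C) (hx : x ∈ C) :
    ∀ᶠ t : ℝ in 𝓝 0, x₀ - t • (x - x₀) ∈ C := by
  obtain ⟨y, hy, rfl⟩ := mem_intrinsicInterior.1 h₀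
  have hmem : ∀ t : ℝ, (y : E) - t • (x - y) ∈ affineSpan ℝ C := by
    intro t
    have := AffineMap.lineMap_mem (-t) y.2 (subset_affineSpan ℝ C hx)
    rw [AffineMap.lineMap_apply] at this
    rw [vadd_eq_add, vsub_eq_sub, neg_smul, neg_add_eq_sub] at this
    exact this
  have hcont : Continuous fun t : ℝ => (⟨(y : E) - t • (x - y), hmem t⟩ : affineSpan ℝ C) :=
    Continuous.subtype_mk (by fun_prop) _
  have h1 := hcont.tendsto 0
  have h2 : (⟨(y : E) - (0 : ℝ) • (x - y), hmem 0⟩ : affineSpan ℝ C) = y := by ext; simp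
  rw [h2] at h1
  exact h1 (mem_interior_iff_mem_nhds.1 hy)

namespace ConstrainedProblem

variable {p n : ℕ} {P : ConstrainedProblem p n}

theorem IsPrimalSolution.mem_effDomain (hP : P.StandingAssumptions) {xs : Vec p}
    (hxs : P.IsPrimalSolution xs) : xs ∈ effDomain P.f := by
  obtain ⟨x, hx, hxK⟩ := hP.slater
  have hfeas : x ∈ P.feasible := intrinsicInterior_subset (𝕜 := ℝ) (s := P.K) hxK
  have hdom : x ∈ effDomain P.f := intrinsicInterior_subset (𝕜 := ℝ) (s := effDomain P.f) hx
  exact (hxs.2 x hfeas).trans_lt hdom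

theorem IsPrimalSolution.optVal_eq (hP : P.StandingAssumptions) {xs : Vec p}
    (hxs : P.IsPrimalSolution xs) : P.optVal = (((P.f xs).toReal : ℝ) : EReal) := by
  rw [hP.proper.coe_toReal (hxs.mem_effDomain hP)]
  exact le_antisymm (iInf₂_le xs hxs.1) (le_iInf₂ hxs.2)

theorem inner_adjoint_neg (x : Vec p) (y : Vec n) :
    inner ℝ x (-(ContinuousLinearMap.adjoint P.A y)) = -inner ℝ (P.A x) y := by
  rw [inner_neg_right, ContinuousLinearMap.adjoint_inner_right]

theorem fenchelConj_ne_bot (hf : IsProperFun P.f) (u : Vec p) : fenchelConj P.f u ≠ ⊥ := by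
  obtain ⟨x, hx⟩ := hf.2
  have h1 : ((inner ℝ x u : ℝ) : EReal) - P.f x ≤ fenchelConj P.f u :=
    le_iSup (fun x : Vec p => ((inner ℝ x u : ℝ) : EReal) - P.f x) x
  rw [← hf.coe_toReal (lt_top_iff_ne_top.2 hx), ← EReal.coe_sub] at h1
  exact ne_of_gt ((EReal.bot_lt_coe _).trans_le h1)

/-- A finite bound on the dual objective, read as a bound on the Lagrangian. -/
theorem le_lagrangian_of_dualObj_le (hP : P.StandingAssumptions) {y : Vec n} {c : ℝ}
    (hc : P.dualObj y ≤ c) :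
    y ∈ effDomain (supportFun P.K) ∧ ∀ x ∈ effDomain P.f,
      -c ≤ (P.f x).toReal + inner ℝ (P.A x - P.b) y - (supportFun P.K y).toReal := by
  have hy : y ∈ effDomain (supportFun P.K) := by
    by_contra hy
    have hy' : supportFun P.K y = ⊤ := by simpa [effDomain] using hy
    rw [dualObj, hy', EReal.add_top_of_ne_bot, top_le_iff] at hc
    · exact EReal.coe_ne_top _ hc
    · exact EReal.add_ne_bot_iff.2 ⟨fenchelConj_ne_bot hP.proper _, EReal.coe_ne_bot _⟩
  refine ⟨hy, fun x hx => ?_⟩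
  have h1 : ((inner ℝ x (-(ContinuousLinearMap.adjoint P.A y)) : ℝ) : EReal) - P.f x
      ≤ fenchelConj P.f (-(ContinuousLinearMap.adjoint P.A y)) :=
    le_iSup (fun x : Vec p =>
      ((inner ℝ x (-(ContinuousLinearMap.adjoint P.A y)) : ℝ) : EReal) - P.f x) x
  have h2 := (add_le_add (add_le_add h1 (le_refl ((inner ℝ P.b y : ℝ) : EReal)))
    (le_refl (supportFun P.K y))).trans hc
  rw [← hP.proper.coe_toReal hx,
    ← EReal.coe_toReal (ne_of_lt hy) (supportFun_ne_bot hP.zero_mem y), ← EReal.coe_sub,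
    ← EReal.coe_add, ← EReal.coe_add, EReal.coe_le_coe_iff, inner_adjoint_neg] at h2
  rw [inner_sub_left]
  linarith

theorem exists_dualObj_le (hP : P.StandingAssumptions) {xs : Vec p}
    (hxs : P.IsPrimalSolution xs) : ∃ y, P.dualObj y ≤ ((-(P.f xs).toReal : ℝ) : EReal) := by
  have hconv := hP.convex.convexOn_toReal hP.proper
  obtain ⟨x₀, hx₀, hx₀K⟩ := hP.slater
  set V : Set (Vec n × ℝ) := {z | ∃ x ∈ effDomain P.f, ∃ u ∈ P.K,
    z.1 = P.A x - P.b - u ∧ (P.f x).toReal ≤ z.2} with hVdef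
  obtain ⟨y, hy⟩ := exists_multiplier_of_convex (V := V) (a := (P.f xs).toReal)
    (by
      rintro z ⟨x, hx, u, hu, h1, h2⟩ z' ⟨x', hx', u', hu', h1', h2'⟩ s t hs ht hst
      refine ⟨s • x + t • x', hconv.1 hx hx' hs ht hst, s • u + t • u',
        hP.set_convex hu hu' hs ht hst, ?_, ?_⟩
      · have hb : P.b = s • P.b + t • P.b := by rw [← add_smul, hst, one_smul]
        rw [Prod.fst_add, Prod.smul_fst, Prod.smul_fst, h1, h1', map_add, map_smul, map_smul]
        nth_rewrite 3 [hb]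
        module
      · have h3 := hconv.2 hx hx' hs ht hst
        simp only [smul_eq_mul, Prod.snd_add, Prod.smul_snd] at h3 ⊢
        have h4 := mul_le_mul_of_nonneg_left h2 hs
        have h5 := mul_le_mul_of_nonneg_left h2' ht
        linarith)
    ⟨xs, hxs.mem_effDomain hP, _, hxs.1, by simp, le_rfl⟩
    (by
      rintro r ⟨x, hx, u, hu, h1, h2⟩
      have hfeas : x ∈ P.feasible := by
        change P.A x - P.b ∈ P.K
        rw [sub_eq_zero.1 h1.symm]
        exact hu
      exact (EReal.toReal_le_toReal (hxs.2 x hfeas) (hP.proper.1 _) (ne_of_lt hx)).trans h2)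
    (by
      rintro z ⟨x, hx, u, hu, h1, -⟩
      have e1 := eventually_sub_smul_mem_of_mem_intrinsicInterior hx₀ hx
      have e2 := eventually_sub_smul_mem_of_mem_intrinsicInterior hx₀K hu
      obtain ⟨ε, ⟨hε1, hε2⟩, hε⟩ :=
        (((e1.and e2).filter_mono nhdsWithin_le_nhds).and
          (self_mem_nhdsWithin (a := (0 : ℝ)) (s := Ioi 0))).exists
      refine ⟨ε, hε, _, _, hε1, _, hε2, ?_, le_rfl⟩
      simp only [h1, map_sub, map_smul]
      module)
  refine ⟨y, ?_⟩
  have hLag : ∀ u ∈ P.K, fenchelConj P.f (-(ContinuousLinearMap.adjoint P.A y))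
      ≤ ((-(P.f xs).toReal - inner ℝ P.b y - inner ℝ u y : ℝ) : EReal) := by
    intro u hu
    refine iSup_le fun x => ?_
    by_cases hx : x ∈ effDomain P.f
    · rw [← hP.proper.coe_toReal hx, ← EReal.coe_sub, EReal.coe_le_coe_iff, inner_adjoint_neg]
      have h1 := hy (P.A x - P.b - u, (P.f x).toReal) ⟨x, hx, u, hu, rfl, le_rfl⟩
      simp only [inner_sub_left] at h1
      linarith
    · have hx' : P.f x = ⊤ := by simpa [effDomain] using hx
      rw [hx', EReal.sub_top]
      exact bot_le
  have hfin := EReal.coe_toReal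
    (ne_of_lt ((hLag 0 hP.zero_mem).trans_lt (EReal.coe_lt_top _)))
    (fenchelConj_ne_bot hP.proper (-(ContinuousLinearMap.adjoint P.A y)))
  set φ := (fenchelConj P.f (-(ContinuousLinearMap.adjoint P.A y))).toReal with hφ
  have hsupp : supportFun P.K y ≤ ((-(P.f xs).toReal - inner ℝ P.b y - φ : ℝ) : EReal) := by
    refine supportFun_le_coe fun u hu => ?_
    have := hLag u hu
    rw [← hfin, EReal.coe_le_coe_iff] at this
    linarith
  rw [dualObj, ← hfin]
  refine (add_le_add (le_refl _) hsupp).trans ?_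
  rw [← EReal.coe_add, ← EReal.coe_add, EReal.coe_le_coe_iff]
  linarith

/-- Strong duality: a dual solution is a Lagrange multiplier. -/
theorem IsDualSolution.le_lagrangian (hP : P.StandingAssumptions) {xs : Vec p}
    (hxs : P.IsPrimalSolution xs) {ys : Vec n} (hys : P.IsDualSolution ys) :
    ys ∈ effDomain (supportFun P.K) ∧ ∀ x ∈ effDomain P.f,
      (P.f xs).toReal ≤
        (P.f x).toReal + inner ℝ (P.A x - P.b) ys - (supportFun P.K ys).toReal := by
  obtain ⟨y, hy⟩ := exists_dualObj_le hP hxs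
  simpa using le_lagrangian_of_dualObj_le hP ((hys y).trans hy)

theorem exists_isDualSolution (hP : P.StandingAssumptions) : ∃ ys, P.IsDualSolution ys := by
  obtain ⟨xs, hxs⟩ := hP.exists_solution
  obtain ⟨y, hy⟩ := exists_dualObj_le hP hxs
  refine ⟨y, fun z => hy.trans ?_⟩
  by_contra hz
  have hz' : P.dualObj z < ((-(P.f xs).toReal : ℝ) : EReal) := not_le.1 hz
  obtain ⟨c, hzc, hc⟩ := EReal.lt_iff_exists_real_btwn.1 hz'
  obtain ⟨hzD, hzL⟩ := le_lagrangian_of_dualObj_le hP hzc.le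
  have h1 := hzL xs (hxs.mem_effDomain hP)
  have h2 := inner_le_toReal_supportFun hzD hxs.1
  have h3 := EReal.coe_lt_coe_iff.1 hc
  linarith

end ConstrainedProblem

/-! ### One stage of accelerated proximal gradient steps -/

/-- The integrand of the smoothed objective
`f(x) + max_y {⟨A x - b, y⟩ - s_K(y) - β b_Y(y, c)}`. Keeping `y` free avoids the maximum:
an upper bound for all `y` in the domain of `s_K` bounds the smoothed objective. -/
noncomputable def smoothedLagrangian {p n : ℕ} (P : ConstrainedProblem p n) (h : Vec n → ℝ) (β : ℝ)
    (c : Vec n) (x : Vec p) (y : Vec n) : ℝ :=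
  (P.f x).toReal + (inner ℝ (P.A x - P.b) y - (supportFun P.K y).toReal - β * bregman h y c)

section Stage

variable {p n : ℕ} {P : ConstrainedProblem p n} {h : Vec n → ℝ} {L : ℝ≥0}

/-- The smoothed dual term has a Lipschitz gradient with constant `‖A‖² / β`. -/
theorem IsDualStep.quadratic_upper_bound (hP : P.StandingAssumptions) (hh : IsProxFunction h L)
    {β : ℝ} (hβ : 0 < β) {u : Vec p} {c y₀ : Vec n} (hs : IsDualStep P h β u c y₀) (v : Vec p)
    {y : Vec n} (hy : y ∈ effDomain (supportFun P.K)) :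
    inner ℝ (P.A v - P.b) y - (supportFun P.K y).toReal - β * bregman h y c
      ≤ inner ℝ (P.A v - P.b) y₀ - (supportFun P.K y₀).toReal - β * bregman h y₀ c
        + ‖P.A‖ ^ 2 / β * halfSqDist v u := by
  have h1 := hs.three_point hP.zero_mem hh.differentiable hy
  have h2 := mul_le_mul_of_nonneg_left (hh.half_sq_le_bregman y y₀) hβ.le
  have h3 : inner ℝ (P.A (v - u)) (y - y₀) ≤ ‖P.A‖ * ‖v - u‖ * ‖y - y₀‖ :=
    (real_inner_le_norm _ _).trans
      (mul_le_mul_of_nonneg_right (P.A.le_opNorm _) (norm_nonneg _))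
  have h4 : ‖P.A‖ * ‖v - u‖ * ‖y - y₀‖
      ≤ ‖P.A‖ ^ 2 / β * (1 / 2 * ‖v - u‖ ^ 2) + β * (1 / 2 * ‖y - y₀‖ ^ 2) := by
    have h5 : ‖P.A‖ ^ 2 / β * (1 / 2 * ‖v - u‖ ^ 2) + β * (1 / 2 * ‖y - y₀‖ ^ 2)
        - ‖P.A‖ * ‖v - u‖ * ‖y - y₀‖ = (‖P.A‖ * ‖v - u‖ - β * ‖y - y₀‖) ^ 2 / (2 * β) := by
      field_simp
      ring
    have : 0 ≤ (‖P.A‖ * ‖v - u‖ - β * ‖y - y₀‖) ^ 2 / (2 * β) := by positivity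
    linarith
  have h6 : inner ℝ (P.A v - P.b) y = inner ℝ (P.A v - P.b) y₀ + inner ℝ (P.A (v - u)) (y - y₀)
      + (inner ℝ (P.A u - P.b) y - inner ℝ (P.A u - P.b) y₀) := by
    simp only [map_sub, inner_sub_left, inner_sub_right]
    ring
  unfold halfSqDist
  linarith

/-- One accelerated step with extrapolation parameter `τ`. At `τ = 1` nothing is required of the
previous iterate `x`, which may then lie outside the domain of `f`. -/
theorem accelerated_step (hP : P.StandingAssumptions) (hh : IsProxFunction h L)
    {β τ B : ℝ} (hβ : 0 < β) (hτ0 : 0 < τ) (hτ1 : τ ≤ 1) {xs : Vec p}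
    (hxs : P.IsPrimalSolution xs) {c y₀ : Vec n} {x u x' z z' : Vec p}
    (hu : u = (1 - τ) • x + τ • z) (hz' : z' = x + (1 / τ) • (x' - x))
    (hdual : IsDualStep P h β u c y₀)
    (hprox : IsProxStep P.f (β / ‖P.A‖ ^ 2) u (ContinuousLinearMap.adjoint P.A y₀) x')
    (hB : τ = 1 ∨ x ∈ effDomain P.f ∧ smoothedLagrangian P h β c x y₀ ≤ B)
    {y : Vec n} (hy : y ∈ effDomain (supportFun P.K)) :
    smoothedLagrangian P h β c x' y ≤ (1 - τ) * B + τ * (P.f xs).toReal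
      + ‖P.A‖ ^ 2 / β * τ ^ 2 * (halfSqDist xs z - halfSqDist xs z') := by
  have hf := hP.proper
  have hxsD := hxs.mem_effDomain hP
  have hconv := hP.convex.convexOn_toReal hf
  have hy₀ := hdual.mem_effDomain hP.zero_mem
  set w := (1 - τ) • x + τ • xs with hw
  -- `xs` is feasible, so the linearized penalty is nonpositive there
  have hΦs : inner ℝ (P.A xs - P.b) y₀ - (supportFun P.K y₀).toReal - β * bregman h y₀ c ≤ 0 := by
    have h1 := inner_le_toReal_supportFun hy₀ hxs.1
    have h2 := mul_nonneg hβ.le (hh.bregman_nonneg y₀ c)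
    linarith
  have hAw : inner ℝ (P.A w - P.b) y₀ =
      (1 - τ) * inner ℝ (P.A x - P.b) y₀ + τ * inner ℝ (P.A xs - P.b) y₀ := by
    simp only [hw, map_add, map_smul, inner_sub_left, inner_add_left, inner_smul_left,
      conj_trivial]
    ring
  have hmodel : w ∈ effDomain P.f ∧ smoothedLagrangian P h β c w y₀
      ≤ (1 - τ) * B + τ * (P.f xs).toReal := by
    have hΦs' := mul_le_mul_of_nonneg_left hΦs hτ0.le
    unfold smoothedLagrangian at hB ⊢
    rcases hB with h1 | ⟨hx, hB⟩
    · have hw' : w = xs := by simp [hw, h1]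
      rw [hw', h1]
      exact ⟨hxsD, by linarith⟩
    · have h1 := hconv.2 hx hxsD (sub_nonneg.2 hτ1) hτ0.le (sub_add_cancel 1 τ)
      have h2 := mul_le_mul_of_nonneg_left hB (sub_nonneg.2 hτ1)
      refine ⟨hconv.1 hx hxsD (sub_nonneg.2 hτ1) hτ0.le (sub_add_cancel 1 τ), ?_⟩
      simp only [smul_eq_mul, ← hw] at h1
      rw [hAw]
      linarith
  have h1 := hdual.quadratic_upper_bound hP hh hβ x' hy
  have h2 := hprox.three_point hf hP.convex hmodel.1
  rw [one_div_div, ContinuousLinearMap.adjoint_inner_left,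
    ContinuousLinearMap.adjoint_inner_left] at h2
  have e1 : halfSqDist w u = τ ^ 2 * halfSqDist xs z := by
    have : w - u = τ • (xs - z) := by rw [hw, hu]; module
    rw [halfSqDist, halfSqDist, this, norm_smul, mul_pow, Real.norm_eq_abs, sq_abs]
    ring
  have e2 : halfSqDist w x' = τ ^ 2 * halfSqDist xs z' := by
    have : w - x' = τ • (xs - z') := by
      have h3 : τ • z' = τ • x + (x' - x) := by
        rw [hz', smul_add, smul_smul, mul_one_div_cancel hτ0.ne', one_smul]
      rw [smul_sub, h3, hw]
      module
    rw [halfSqDist, halfSqDist, this, norm_smul, mul_pow, Real.norm_eq_abs, sq_abs]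
    ring
  have e3 : inner ℝ y₀ (P.A (w - u)) - inner ℝ y₀ (P.A (x' - u))
      = inner ℝ (P.A w - P.b) y₀ - inner ℝ (P.A x' - P.b) y₀ := by
    simp only [map_sub, inner_sub_right, real_inner_comm y₀]
    ring
  have h4 := hmodel.2
  unfold smoothedLagrangian at h4 ⊢
  rw [e1, e2] at h2
  have e4 : ‖P.A‖ ^ 2 / β * τ ^ 2 * (halfSqDist xs z - halfSqDist xs z')
      = ‖P.A‖ ^ 2 / β * (τ ^ 2 * halfSqDist xs z) - ‖P.A‖ ^ 2 / β * (τ ^ 2 * halfSqDist xs z') := by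
    ring
  rw [e4]
  linarith

/-- The estimate after `j + 1` steps of a stage. The gap in the smoothed objective need not be
nonnegative by itself; it becomes so after adding `β b_Y(y⋆, c)`, which accounts for the
term growing with `j`. -/
theorem accelerated_stage (hP : P.StandingAssumptions) (hh : IsProxFunction h L)
    {β : ℝ} (hβ : 0 < β) {xs : Vec p} (hxs : P.IsPrimalSolution xs)
    {ys : Vec n} (hys : P.IsDualSolution ys) {c : Vec n} {m : ℕ}
    {x u z : ℕ → Vec p} {yt : ℕ → Vec n} {τ : ℕ → ℝ}
    (hτ : ∀ j < m, τ j = 2 / ((j : ℝ) + 2))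
    (hu : ∀ j < m, u j = (1 - τ j) • x j + τ j • z j)
    (hz : ∀ j < m, z (j + 1) = x j + (1 / τ j) • (x (j + 1) - x j))
    (hdual : ∀ j < m, IsDualStep P h β (u j) c (yt (j + 1)))
    (hprox : ∀ j < m, IsProxStep P.f (β / ‖P.A‖ ^ 2) (u j)
      (ContinuousLinearMap.adjoint P.A (yt (j + 1))) (x (j + 1))) :
    ∀ j < m, x (j + 1) ∈ effDomain P.f ∧ ∀ y ∈ effDomain (supportFun P.K),
      ((j : ℝ) + 2) ^ 2 / 4 * (smoothedLagrangian P h β c (x (j + 1)) y - (P.f xs).toReal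
          + β * bregman h ys c)
        ≤ ((j : ℝ) + 1) * (j + 4) / 4 * (β * bregman h ys c)
          + ‖P.A‖ ^ 2 / β * (halfSqDist xs (z 0) - halfSqDist xs (z (j + 1))) := by
  obtain ⟨hysD, hLag⟩ := hys.le_lagrangian hP hxs
  intro j
  induction j with
  | zero =>
    intro hj
    refine ⟨(hprox 0 hj).mem_effDomain hP.proper, fun y hy => ?_⟩
    have h1 : τ 0 = 1 := by rw [hτ 0 hj]; norm_num
    have h2 := accelerated_step (B := 0) hP hh hβ (by rw [h1]; norm_num) h1.le hxs (hu 0 hj)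
      (hz 0 hj) (hdual 0 hj) (hprox 0 hj) (Or.inl h1) hy
    rw [h1] at h2
    norm_num at h2 ⊢
    linarith
  | succ j ih =>
    intro hj
    obtain ⟨hxD, hIH⟩ := ih (by omega)
    refine ⟨(hprox _ hj).mem_effDomain hP.proper, fun y hy => ?_⟩
    set b := β * bregman h ys c with hb
    set M := ‖P.A‖ ^ 2 / β with hM
    set Q := ((j : ℝ) + 1) * (j + 4) / 4 * b
      + M * (halfSqDist xs (z 0) - halfSqDist xs (z (j + 1))) with hQ
    have hQ0 : 0 ≤ Q := by
      refine le_trans ?_ (hIH ys hysD)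
      have h1 := hLag _ hxD
      have : 0 ≤ smoothedLagrangian P h β c (x (j + 1)) ys - (P.f xs).toReal + b := by
        unfold smoothedLagrangian
        linarith
      positivity
    have hτj : τ (j + 1) = 2 / ((j : ℝ) + 3) := by
      rw [hτ _ hj]; push_cast; ring
    have hj3 : (0 : ℝ) < (j : ℝ) + 3 := by positivity
    have hj2 : (0 : ℝ) < (j : ℝ) + 2 := by positivity
    have hy₀ := (hdual _ hj).mem_effDomain hP.zero_mem
    have hB : smoothedLagrangian P h β c (x (j + 1)) (yt (j + 1 + 1))
        ≤ (P.f xs).toReal - b + 4 / ((j : ℝ) + 2) ^ 2 * Q := by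
      have h1 := mul_le_mul_of_nonneg_left (hIH _ hy₀)
        (by positivity : (0 : ℝ) ≤ 4 / ((j : ℝ) + 2) ^ 2)
      rw [← mul_assoc, show 4 / ((j : ℝ) + 2) ^ 2 * (((j : ℝ) + 2) ^ 2 / 4) = 1 by field_simp,
        one_mul] at h1
      linarith
    have h2 := accelerated_step hP hh hβ (by rw [hτj]; positivity)
      (by rw [hτj, div_le_one hj3]; linarith [(Nat.cast_nonneg j : (0 : ℝ) ≤ j)]) hxs (hu _ hj)
      (hz _ hj) (hdual _ hj) (hprox _ hj) (Or.inr ⟨hxD, hB⟩) hy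
    rw [← hM, hτj] at h2
    have h3 : smoothedLagrangian P h β c (x (j + 1 + 1)) y - (P.f xs).toReal + b
        ≤ 2 / ((j : ℝ) + 3) * b + (1 - 2 / ((j : ℝ) + 3)) * (4 / ((j : ℝ) + 2) ^ 2 * Q)
          + M * (2 / ((j : ℝ) + 3)) ^ 2 *
            (halfSqDist xs (z (j + 1)) - halfSqDist xs (z (j + 1 + 1))) := by
      linarith
    have h4 := mul_le_mul_of_nonneg_left h3 (by positivity : (0 : ℝ) ≤ ((j : ℝ) + 3) ^ 2 / 4)
    -- `(1 - τⱼ) / τⱼ² ≤ 1 / τⱼ₋₁²`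
    have h5 : ((j : ℝ) + 3) ^ 2 / 4 * ((1 - 2 / ((j : ℝ) + 3)) * (4 / ((j : ℝ) + 2) ^ 2 * Q))
        ≤ Q := by
      have : ((j : ℝ) + 3) ^ 2 / 4 * ((1 - 2 / ((j : ℝ) + 3)) * (4 / ((j : ℝ) + 2) ^ 2 * Q))
          = Q - Q / ((j : ℝ) + 2) ^ 2 := by
        field_simp
        ring
      rw [this]
      have : 0 ≤ Q / ((j : ℝ) + 2) ^ 2 := by positivity
      linarith
    have h6 : ((j : ℝ) + 3) ^ 2 / 4 * (2 / ((j : ℝ) + 3) * b) = ((j : ℝ) + 3) / 2 * b := by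
      field_simp
      ring
    have h7 : ∀ D : ℝ, ((j : ℝ) + 3) ^ 2 / 4 * (M * (2 / ((j : ℝ) + 3)) ^ 2 * D) = M * D := by
      intro D
      field_simp
      ring
    rw [mul_add _ (2 / ((j : ℝ) + 3) * b + _), mul_add _ (2 / ((j : ℝ) + 3) * b), h6, h7] at h4
    push_cast
    have e1 : ((j : ℝ) + 1 + 2) ^ 2 / 4 = ((j : ℝ) + 3) ^ 2 / 4 := by ring
    rw [e1]
    linarith [h5.trans_eq hQ]

end Stage

/-! ### Growth of the parameters -/

section Parameters

variable {ω β₀ : ℝ} {m₀ : ℕ}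

theorem innerCount_succ_bounds (hω : 1 < ω) (s : ℕ) :
    ω * ((innerCount ω m₀ s : ℝ) + 1) ≤ (innerCount ω m₀ (s + 1) : ℝ) + 1 ∧
      (innerCount ω m₀ (s + 1) : ℝ) ≤ ω * ((innerCount ω m₀ s : ℝ) + 1) := by
  have hpos : 0 ≤ ω * ((innerCount ω m₀ s : ℝ) + 1) := by positivity
  have h1 : 1 ≤ ⌊ω * ((innerCount ω m₀ s : ℝ) + 1) + 1⌋₊ := by
    rw [Nat.le_floor_iff (by positivity)]
    push_cast
    linarith
  have h2 : (innerCount ω m₀ (s + 1) : ℝ)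
      = (⌊ω * ((innerCount ω m₀ s : ℝ) + 1) + 1⌋₊ : ℝ) - 1 := by
    rw [innerCount, Nat.cast_sub h1, Nat.cast_one]
  have h3 := Nat.lt_floor_add_one (ω * ((innerCount ω m₀ s : ℝ) + 1) + 1)
  have h4 := Nat.floor_le (by positivity : 0 ≤ ω * ((innerCount ω m₀ s : ℝ) + 1) + 1)
  rw [h2]
  constructor <;> linarith

theorem pow_mul_le_innerCount (hω : 1 < ω) (s : ℕ) :
    ω ^ s * ((m₀ : ℝ) + 1) ≤ (innerCount ω m₀ s : ℝ) + 1 := by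
  induction s with
  | zero => simp [innerCount]
  | succ s ih =>
    have h1 := mul_le_mul_of_nonneg_left ih (by linarith : (0 : ℝ) ≤ ω)
    have h2 := (innerCount_succ_bounds (m₀ := m₀) hω s).1
    rw [pow_succ']
    linarith

theorem one_le_innerCount (hω : 1 < ω) (hm₀ : 1 ≤ m₀) (s : ℕ) : 1 ≤ innerCount ω m₀ s := by
  have h1 := pow_mul_le_innerCount (m₀ := m₀) hω s
  have h2 : 1 ≤ ω ^ s := one_le_pow₀ hω.le
  have h3 : (1 : ℝ) ≤ m₀ := by exact_mod_cast hm₀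
  have h4 : (1 : ℝ) ≤ innerCount ω m₀ s := by nlinarith
  exact_mod_cast h4

theorem innerCount_add_le (hω : 1 < ω) (s : ℕ) :
    (innerCount ω m₀ s : ℝ) + ω / (ω - 1) ≤ ω ^ s * kappaZero ω m₀ := by
  have hω' : ω - 1 ≠ 0 := by linarith
  induction s with
  | zero => simp [innerCount, kappaZero]
  | succ s ih =>
    have h1 := mul_le_mul_of_nonneg_left ih (by linarith : (0 : ℝ) ≤ ω)
    have h2 := (innerCount_succ_bounds (m₀ := m₀) hω s).2
    have h3 : ω * (ω / (ω - 1)) = ω + ω / (ω - 1) := by field_simp; ring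
    rw [pow_succ']
    linarith

theorem restartIndex_le (hω : 1 < ω) (s : ℕ) :
    (ω - 1) * (restartIndex ω m₀ s : ℝ) + kappaZero ω m₀ ≤ ω ^ s * kappaZero ω m₀ := by
  induction s with
  | zero => simp [restartIndex]
  | succ s ih =>
    have h1 := mul_le_mul_of_nonneg_left (innerCount_add_le (m₀ := m₀) hω s)
      (by linarith : (0 : ℝ) ≤ ω - 1)
    have h2 : (ω - 1) * (ω / (ω - 1)) = ω := mul_div_cancel₀ _ (by linarith)
    rw [restartIndex, pow_succ', Nat.cast_add]
    linarith

theorem kappaZero_pos (hω : 1 < ω) : 0 < kappaZero ω m₀ := by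
  have : 0 < ω / (ω - 1) := div_pos (by linarith) (by linarith)
  unfold kappaZero
  positivity

theorem rateDenom_pos (hω : 1 < ω) (s : ℕ) : 0 < rateDenom ω m₀ s :=
  add_pos_of_nonneg_of_pos (mul_nonneg (by linarith) (Nat.cast_nonneg _)) (kappaZero_pos hω)

/-- Geometric decay in the stage is decay of order `1 / K` in the total iteration count. -/
theorem inv_pow_le_rate (hω : 1 < ω) (s : ℕ) :
    (ω ^ s)⁻¹ ≤ ω * kappaZero ω m₀ / rateDenom ω m₀ s := by
  have h1 := restartIndex_le (m₀ := m₀) hω (s + 1)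
  rw [pow_succ'] at h1
  rw [le_div_iff₀ (rateDenom_pos hω s), inv_mul_le_iff₀ (by positivity)]
  unfold rateDenom
  linarith

theorem rhoZero_pos (hω : 1 < ω) (hβ₀ : 0 < β₀) (hm₀ : 1 / (ω - 1) < (m₀ : ℝ)) :
    0 < rhoZero ω β₀ m₀ := by
  have h1 : 0 < ω - 1 := by linarith
  have h2 : 0 < (m₀ : ℝ) := lt_trans (by positivity) hm₀
  rw [div_lt_iff₀ h1] at hm₀
  refine mul_pos hβ₀ (sub_pos.2 ?_)
  rw [div_lt_one (by positivity)]
  linarith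

theorem smoothParam_bounds (hω : 1 < ω) (hβ₀ : 0 < β₀) (hm₀ : 1 / (ω - 1) < (m₀ : ℝ))
    (s : ℕ) : rhoZero ω β₀ m₀ ≤ ω ^ s * smoothParam ω β₀ m₀ s ∧
      ω ^ s * smoothParam ω β₀ m₀ s ≤ β₀ := by
  have h1 : 0 < ω - 1 := by linarith
  have hω0 : 0 < ω := by linarith
  have hm : 0 < (m₀ : ℝ) := lt_trans (by positivity) hm₀
  -- The product of the factors `(m + 1) / √(m (m + 3))` is bounded below by one minus the
  -- partial sum of the geometric series `∑ ω⁻ⁱ / m₀`.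
  have key : ∀ s, β₀ * (1 - (1 - (ω ^ s)⁻¹) / ((ω - 1) * m₀)) ≤ ω ^ s * smoothParam ω β₀ m₀ s ∧
      ω ^ s * smoothParam ω β₀ m₀ s ≤ β₀ ∧ 0 ≤ ω ^ s * smoothParam ω β₀ m₀ s := by
    intro s
    induction s with
    | zero => simp [smoothParam, hβ₀.le]
    | succ s ih =>
      obtain ⟨ih1, ih2, ih3⟩ := ih
      set X := ω ^ s * smoothParam ω β₀ m₀ s with hX
      set m : ℝ := (innerCount ω m₀ (s + 1) : ℝ) with hmdef
      have hm1 : 1 ≤ m := Nat.one_le_cast.2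
        (one_le_innerCount hω (Nat.cast_pos.1 hm) (s + 1))
      have hr0 : 0 < Real.sqrt (m * (m + 3)) := Real.sqrt_pos.2 (by positivity)
      have hr1 : m + 1 ≤ Real.sqrt (m * (m + 3)) := Real.le_sqrt_of_sq_le (by nlinarith)
      have hr2 : Real.sqrt (m * (m + 3)) ≤ m + 3 / 2 :=
        Real.sqrt_le_iff.2 ⟨by positivity, by nlinarith⟩
      have hXs : ω ^ (s + 1) * smoothParam ω β₀ m₀ (s + 1)
          = X * ((m + 1) / Real.sqrt (m * (m + 3))) := by
        rw [smoothParam, ← hmdef, hX, pow_succ]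
        field_simp
      have hq1 : (m + 1) / Real.sqrt (m * (m + 3)) ≤ 1 := (div_le_one hr0).2 hr1
      have hq2 : 1 - (ω ^ (s + 1))⁻¹ / m₀ ≤ (m + 1) / Real.sqrt (m * (m + 3)) := by
        have h2 : 1 - 1 / (m + 1) ≤ (m + 1) / Real.sqrt (m * (m + 3)) := by
          rw [le_div_iff₀ hr0]
          have h3 : 1 - 1 / (m + 1) = m / (m + 1) := by field_simp; ring
          rw [h3, div_mul_eq_mul_div, div_le_iff₀ (by positivity)]
          nlinarith
        have h3 : 1 / (m + 1) ≤ (ω ^ (s + 1))⁻¹ / m₀ := by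
          rw [← one_div, div_div]
          refine one_div_le_one_div_of_le (by positivity) ?_
          have h4 := pow_mul_le_innerCount (m₀ := m₀) hω (s + 1)
          have h5 : 0 < ω ^ (s + 1) := by positivity
          linarith
        linarith
      rw [hXs]
      refine ⟨?_, (mul_le_of_le_one_right ih3 hq1).trans ih2, by positivity⟩
      have h2 := mul_le_mul_of_nonneg_left hq2 ih3
      have h3 : X * ((ω ^ (s + 1))⁻¹ / m₀) ≤ β₀ * ((ω ^ (s + 1))⁻¹ / m₀) :=
        mul_le_mul_of_nonneg_right ih2 (by positivity)
      have h4 : β₀ * (1 - (1 - (ω ^ (s + 1))⁻¹) / ((ω - 1) * m₀))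
          = β₀ * (1 - (1 - (ω ^ s)⁻¹) / ((ω - 1) * m₀)) - β₀ * ((ω ^ (s + 1))⁻¹ / m₀) := by
        rw [pow_succ]
        field_simp
        ring
      rw [h4]
      linarith
  obtain ⟨h2, h3, -⟩ := key s
  refine ⟨le_trans ?_ h2, h3⟩
  refine mul_le_mul_of_nonneg_left (sub_le_sub_left ?_ _) hβ₀.le
  refine div_le_div_of_nonneg_right ?_ (by positivity)
  have : 0 < (ω ^ s)⁻¹ := by positivity
  linarith

end Parameters

/-! ### Contraction over the stages -/

/-- The energy `R_s²` at the beginning of stage `s`; it is divided by at least `ω²` at each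
restart. -/
noncomputable def stageEnergy {p n : ℕ} (P : ConstrainedProblem p n) (h : Vec n → ℝ)
    (ω β₀ : ℝ) (m₀ : ℕ) (xtil : ℕ → Vec p) (ydot : ℕ → Vec n) (xs : Vec p) (ys : Vec n)
    (s : ℕ) : ℝ :=
  4 * ‖P.A‖ ^ 2 / ((innerCount ω m₀ s : ℝ) + 1) ^ 2 * halfSqDist xs (xtil (restartIndex ω m₀ s))
    + smoothParam ω β₀ m₀ s ^ 2 * (innerCount ω m₀ s : ℝ) * ((innerCount ω m₀ s : ℝ) + 3)
      / ((innerCount ω m₀ s : ℝ) + 1) ^ 2 * bregman h ys (ydot s)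

section Run

variable {p n : ℕ} {P : ConstrainedProblem p n} {h : Vec n → ℝ} {L : ℝ≥0} {ω β₀ : ℝ} {m₀ : ℕ}
  {x₀ : Vec p} {y₀ : Vec n} {xbar xtil : ℕ → Vec p} {ytil ydot : ℕ → Vec n} {tau : ℕ → ℝ}
  {xs : Vec p} {ys : Vec n}

theorem halfSqDist_nonneg {d : ℕ} (u v : Vec d) : 0 ≤ halfSqDist u v := by
  unfold halfSqDist; positivity

theorem smoothParam_pos (hω : 1 < ω) (hβ₀ : 0 < β₀) (hm₀ : 1 / (ω - 1) < (m₀ : ℝ)) (s : ℕ) :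
    0 < smoothParam ω β₀ m₀ s := by
  have h1 := (rhoZero_pos hω hβ₀ hm₀).trans_le (smoothParam_bounds hω hβ₀ hm₀ s).1
  exact pos_of_mul_pos_right h1 (by positivity)

/-- The energy estimate of a whole stage, for every multiplier `y`. -/
theorem IsDoubleLoopRun.stage_estimate (hP : P.StandingAssumptions) (hh : IsProxFunction h L)
    (hω : 1 < ω) (hβ₀ : 0 < β₀) (hm₀ : 1 / (ω - 1) < (m₀ : ℝ))
    (hrun : IsDoubleLoopRun P h ω β₀ m₀ x₀ y₀ xbar xtil ytil ydot tau)
    (hxs : P.IsPrimalSolution xs) (hys : P.IsDualSolution ys) (s : ℕ) :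
    xbar (restartIndex ω m₀ (s + 1)) ∈ effDomain P.f ∧ ∀ y ∈ effDomain (supportFun P.K),
      smoothParam ω β₀ m₀ s * (smoothedLagrangian P h (smoothParam ω β₀ m₀ s) (ydot s)
          (xbar (restartIndex ω m₀ (s + 1))) y - (P.f xs).toReal
          + smoothParam ω β₀ m₀ s * bregman h ys (ydot s))
        + 4 * ‖P.A‖ ^ 2 / ((innerCount ω m₀ s : ℝ) + 1) ^ 2
          * halfSqDist xs (xtil (restartIndex ω m₀ (s + 1)))
        ≤ stageEnergy P h ω β₀ m₀ xtil ydot xs ys s := by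
  have hβ := smoothParam_pos hω hβ₀ hm₀ s
  have hm1 : 1 ≤ m₀ := by
    have : 0 < (m₀ : ℝ) := lt_trans (one_div_pos.2 (by linarith)) hm₀
    exact_mod_cast this
  obtain ⟨m, hm⟩ := Nat.exists_eq_add_of_le' (one_le_innerCount hω hm1 s)
  have hm' := one_le_innerCount hω hm1 (s + 1)
  set k := restartIndex ω m₀ s with hk
  set β := smoothParam ω β₀ m₀ s with hβdef
  have hk' : restartIndex ω m₀ (s + 1) = k + (m + 1) := by rw [restartIndex, hm]
  -- the auxiliary sequence of the accelerated method
  let z : ℕ → Vec p := fun j => Nat.casesOn j (xtil k)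
    (fun i => xbar (k + i) + (1 / tau (k + i)) • (xbar (k + (i + 1)) - xbar (k + i)))
  have hτ : ∀ j < m + 1, tau (k + j) = 2 / ((j : ℝ) + 2) := fun j hj =>
    hrun.tau_eq s j (by rw [hm]; exact hj)
  have hu : ∀ j < m + 1,
      xtil (k + j) = (1 - tau (k + j)) • xbar (k + j) + tau (k + j) • z j := by
    intro j hj
    cases j with
    | zero =>
      have h1 : tau (k + 0) = 1 := by rw [hτ 0 hj]; norm_num
      rw [h1]
      simp [z]
    | succ i =>
      change xtil (k + i + 1) = _
      rw [hrun.extrapolation (k + i)]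
      have ht : tau (k + i) ≠ 0 := by rw [hτ i (by omega)]; positivity
      simp only [z, ← Nat.add_assoc]
      match_scalars <;> field_simp <;> ring
  have hmain := accelerated_stage (m := m + 1) (x := fun j => xbar (k + j))
    (u := fun j => xtil (k + j)) (z := z) (yt := fun j => ytil (k + j))
    (τ := fun j => tau (k + j)) (β := β) (c := ydot s)
    hP hh hβ hxs hys hτ hu (fun j _ => rfl)
    (fun j hj => hrun.dual_step s j (by rw [hm]; exact hj))
    (fun j hj => hrun.prox_step s j (by rw [hm]; exact hj)) m (Nat.lt_succ_self m)
  -- the closing extrapolation returns the last auxiliary iterate, as `τ` is reset to `1`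
  have hz : z (m + 1) = xtil (k + (m + 1)) := by
    have h1 : tau (k + m + 1) = 1 := by
      have := hrun.tau_eq (s + 1) 0 hm'
      rw [hk', add_zero] at this
      rw [Nat.add_assoc, this]
      norm_num
    change _ = xtil (k + m + 1)
    rw [hrun.extrapolation (k + m), h1]
    have ht : tau (k + m) ≠ 0 := by rw [hτ m (by omega)]; positivity
    simp only [z, ← Nat.add_assoc]
    match_scalars <;> field_simp <;> ring
  rw [hk']
  refine ⟨hmain.1, fun y hy => ?_⟩
  have h2 := hmain.2 y hy
  have hz0 : z 0 = xtil k := rfl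
  rw [hz, hz0] at h2
  unfold stageEnergy
  rw [hm, ← hk, ← hβdef]
  push_cast
  have h3 := mul_le_mul_of_nonneg_left h2 (by positivity : 0 ≤ 4 * β / ((m : ℝ) + 2) ^ 2)
  have e1 : ∀ G : ℝ, 4 * β / ((m : ℝ) + 2) ^ 2 * (((m : ℝ) + 2) ^ 2 / 4 * G) = β * G := by
    intro G; field_simp
  have e2 : ∀ b D D' : ℝ, 4 * β / ((m : ℝ) + 2) ^ 2 * (((m : ℝ) + 1) * (m + 4) / 4 * (β * b)
      + ‖P.A‖ ^ 2 / β * (D - D')) = β ^ 2 * ((m : ℝ) + 1) * ((m : ℝ) + 1 + 3)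
        / ((m : ℝ) + 1 + 1) ^ 2 * b + 4 * ‖P.A‖ ^ 2 / ((m : ℝ) + 1 + 1) ^ 2 * D
        - 4 * ‖P.A‖ ^ 2 / ((m : ℝ) + 1 + 1) ^ 2 * D' := by
    intro b D D'
    have : (m : ℝ) + 1 + 1 = m + 2 := by ring
    rw [this]
    field_simp
    ring
  rw [e1, e2] at h3
  linarith

/-- At the end of a stage the gap dominates `β b_Y(y⋆, ydot (s + 1))`, by the three-point inequality
of the center step tested at the dual solution. -/
theorem IsDoubleLoopRun.center_estimate (hP : P.StandingAssumptions) (hh : IsProxFunction h L)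
    (hω : 1 < ω) (hβ₀ : 0 < β₀) (hm₀ : 1 / (ω - 1) < (m₀ : ℝ))
    (hrun : IsDoubleLoopRun P h ω β₀ m₀ x₀ y₀ xbar xtil ytil ydot tau)
    (hxs : P.IsPrimalSolution xs) (hys : P.IsDualSolution ys) (s : ℕ) :
    smoothParam ω β₀ m₀ s ^ 2 * bregman h ys (ydot (s + 1))
        + 4 * ‖P.A‖ ^ 2 / ((innerCount ω m₀ s : ℝ) + 1) ^ 2
          * halfSqDist xs (xtil (restartIndex ω m₀ (s + 1)))
      ≤ stageEnergy P h ω β₀ m₀ xtil ydot xs ys s := by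
  have hβ := smoothParam_pos hω hβ₀ hm₀ s
  obtain ⟨hysD, hLag⟩ := hys.le_lagrangian hP hxs
  obtain ⟨hxD, hstage⟩ := hrun.stage_estimate hP hh hω hβ₀ hm₀ hxs hys s
  have hc := hrun.center_step s
  have h1 := hstage _ (hc.mem_effDomain hP.zero_mem)
  have h2 := hc.three_point hP.zero_mem hh.differentiable hysD
  have h3 := hLag _ hxD
  unfold smoothedLagrangian at h1
  set β := smoothParam ω β₀ m₀ s
  have h4 : β * bregman h ys (ydot (s + 1)) ≤
      (P.f (xbar (restartIndex ω m₀ (s + 1)))).toReal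
        + (inner ℝ (P.A (xbar (restartIndex ω m₀ (s + 1))) - P.b) (ydot (s + 1))
          - (supportFun P.K (ydot (s + 1))).toReal - β * bregman h (ydot (s + 1)) (ydot s))
        - (P.f xs).toReal + β * bregman h ys (ydot s) := by
    linarith
  have h5 := mul_le_mul_of_nonneg_left h4 hβ.le
  rw [← mul_assoc, ← sq] at h5
  linarith

theorem one_le_innerCount_of_lt (hω : 1 < ω) (hm₀ : 1 / (ω - 1) < (m₀ : ℝ)) (s : ℕ) :
    (1 : ℝ) ≤ innerCount ω m₀ s := by
  have h1 : 0 < (m₀ : ℝ) := lt_trans (one_div_pos.2 (by linarith)) hm₀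
  exact_mod_cast one_le_innerCount hω (by exact_mod_cast h1) s

theorem IsDoubleLoopRun.stageEnergy_succ_le (hP : P.StandingAssumptions)
    (hh : IsProxFunction h L) (hω : 1 < ω) (hβ₀ : 0 < β₀) (hm₀ : 1 / (ω - 1) < (m₀ : ℝ))
    (hrun : IsDoubleLoopRun P h ω β₀ m₀ x₀ y₀ xbar xtil ytil ydot tau)
    (hxs : P.IsPrimalSolution xs) (hys : P.IsDualSolution ys) (s : ℕ) :
    ω ^ 2 * stageEnergy P h ω β₀ m₀ xtil ydot xs ys (s + 1)
      ≤ stageEnergy P h ω β₀ m₀ xtil ydot xs ys s := by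
  refine le_trans ?_ (hrun.center_estimate hP hh hω hβ₀ hm₀ hxs hys s)
  have hω0 : 0 < ω := by linarith
  have hm1 := one_le_innerCount_of_lt hω hm₀ (s + 1)
  have hg := (innerCount_succ_bounds (m₀ := m₀) hω s).1
  unfold stageEnergy
  rw [smoothParam]
  set m : ℝ := (innerCount ω m₀ s : ℝ)
  set m' : ℝ := (innerCount ω m₀ (s + 1) : ℝ)
  set D := halfSqDist xs (xtil (restartIndex ω m₀ (s + 1)))
  have hD : 0 ≤ D := halfSqDist_nonneg _ _
  have hm0 : 0 ≤ m := Nat.cast_nonneg _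
  have hr : Real.sqrt (m' * (m' + 3)) ^ 2 = m' * (m' + 3) := Real.sq_sqrt (by positivity)
  have e1 : ∀ β b : ℝ, ω ^ 2 * ((β * (m' + 1) / (ω * Real.sqrt (m' * (m' + 3)))) ^ 2 * m'
      * (m' + 3) / (m' + 1) ^ 2 * b) = β ^ 2 * b := by
    intro β b
    rw [div_pow, mul_pow, mul_pow, hr]
    field_simp
  have e2 : ω ^ 2 * (4 * ‖P.A‖ ^ 2 / (m' + 1) ^ 2 * D) ≤ 4 * ‖P.A‖ ^ 2 / (m + 1) ^ 2 * D := by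
    rw [← mul_assoc]
    refine mul_le_mul_of_nonneg_right ?_ hD
    rw [← mul_div_assoc, div_le_div_iff₀ (by positivity) (by positivity)]
    have h1 : (ω * (m + 1)) ^ 2 ≤ (m' + 1) ^ 2 := pow_le_pow_left₀ (by positivity) hg 2
    have h2 := mul_le_mul_of_nonneg_left h1 (by positivity : 0 ≤ 4 * ‖P.A‖ ^ 2)
    linarith
  rw [mul_add, e1]
  linarith

theorem IsDoubleLoopRun.stageEnergy_zero_eq (hh : IsProxFunction h L)
    (hrun : IsDoubleLoopRun P h ω β₀ m₀ x₀ y₀ xbar xtil ytil ydot tau) :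
    stageEnergy P h ω β₀ m₀ xtil ydot xs ys 0 = RZero P h β₀ m₀ x₀ y₀ xs ys ^ 2 := by
  have h1 := hh.bregman_nonneg ys y₀
  have h2 := halfSqDist_nonneg xs x₀
  rw [RZero, Real.sq_sqrt (by positivity)]
  simp only [stageEnergy, innerCount, restartIndex, smoothParam, hrun.xtil_zero, hrun.ydot_zero]

theorem IsDoubleLoopRun.stageEnergy_le (hP : P.StandingAssumptions)
    (hh : IsProxFunction h L) (hω : 1 < ω) (hβ₀ : 0 < β₀) (hm₀ : 1 / (ω - 1) < (m₀ : ℝ))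
    (hrun : IsDoubleLoopRun P h ω β₀ m₀ x₀ y₀ xbar xtil ytil ydot tau)
    (hxs : P.IsPrimalSolution xs) (hys : P.IsDualSolution ys) (s : ℕ) :
    (ω ^ s) ^ 2 * stageEnergy P h ω β₀ m₀ xtil ydot xs ys s
      ≤ RZero P h β₀ m₀ x₀ y₀ xs ys ^ 2 := by
  induction s with
  | zero => simp [hrun.stageEnergy_zero_eq hh]
  | succ s ih =>
    have h1 := mul_le_mul_of_nonneg_left
      (hrun.stageEnergy_succ_le hP hh hω hβ₀ hm₀ hxs hys s) (sq_nonneg (ω ^ s))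
    have h2 : (ω ^ (s + 1)) ^ 2 = (ω ^ s) ^ 2 * ω ^ 2 := by ring
    rw [h2, mul_assoc]
    exact h1.trans ih

/-- Both centers of a stage lie within `√2 R₀ / ρ₀` of the dual solution. -/
theorem IsDoubleLoopRun.norm_center_sub_le (hP : P.StandingAssumptions)
    (hh : IsProxFunction h L) (hω : 1 < ω) (hβ₀ : 0 < β₀) (hm₀ : 1 / (ω - 1) < (m₀ : ℝ))
    (hrun : IsDoubleLoopRun P h ω β₀ m₀ x₀ y₀ xbar xtil ytil ydot tau)
    (hxs : P.IsPrimalSolution xs) (hys : P.IsDualSolution ys) (s : ℕ) :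
    ‖ys - ydot s‖ ≤ Real.sqrt 2 * (RZero P h β₀ m₀ x₀ y₀ xs ys / rhoZero ω β₀ m₀) ∧
      ‖ys - ydot (s + 1)‖
        ≤ Real.sqrt 2 * (RZero P h β₀ m₀ x₀ y₀ xs ys / rhoZero ω β₀ m₀) := by
  have hρ := rhoZero_pos hω hβ₀ hm₀
  have hβ := smoothParam_pos hω hβ₀ hm₀ s
  have hR : 0 ≤ RZero P h β₀ m₀ x₀ y₀ xs ys := Real.sqrt_nonneg _
  have hE := hrun.stageEnergy_le hP hh hω hβ₀ hm₀ hxs hys s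
  have hlow := (smoothParam_bounds hω hβ₀ hm₀ s).1
  have hm1 := one_le_innerCount_of_lt hω hm₀ s
  have key : ∀ b : ℝ, 0 ≤ b →
      smoothParam ω β₀ m₀ s ^ 2 * b ≤ stageEnergy P h ω β₀ m₀ xtil ydot xs ys s →
      b ≤ (RZero P h β₀ m₀ x₀ y₀ xs ys / rhoZero ω β₀ m₀) ^ 2 := by
    intro b hb hbE
    rw [div_pow, le_div_iff₀ (by positivity)]
    have h1 := mul_le_mul_of_nonneg_left (pow_le_pow_left₀ hρ.le hlow 2) hb
    have h2 := mul_le_mul_of_nonneg_left hbE (sq_nonneg (ω ^ s))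
    calc b * rhoZero ω β₀ m₀ ^ 2 ≤ b * (ω ^ s * smoothParam ω β₀ m₀ s) ^ 2 := h1
      _ = (ω ^ s) ^ 2 * (smoothParam ω β₀ m₀ s ^ 2 * b) := by ring
      _ ≤ _ := h2.trans hE
  constructor
  · refine hh.norm_sub_le (by positivity) (key _ (hh.bregman_nonneg _ _) ?_)
    unfold stageEnergy
    set m : ℝ := (innerCount ω m₀ s : ℝ)
    have h1 := hh.bregman_nonneg ys (ydot s)
    have h2 : 0 ≤ 4 * ‖P.A‖ ^ 2 / (m + 1) ^ 2 * halfSqDist xs (xtil (restartIndex ω m₀ s)) :=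
      mul_nonneg (by positivity) (halfSqDist_nonneg _ _)
    have h3 : smoothParam ω β₀ m₀ s ^ 2
        ≤ smoothParam ω β₀ m₀ s ^ 2 * m * (m + 3) / (m + 1) ^ 2 := by
      rw [le_div_iff₀ (by positivity), mul_assoc]
      exact mul_le_mul_of_nonneg_left (by nlinarith) (sq_nonneg _)
    have h4 := mul_le_mul_of_nonneg_right h3 h1
    linarith
  · refine hh.norm_sub_le (by positivity) (key _ (hh.bregman_nonneg _ _) ?_)
    have h1 := hrun.center_estimate hP hh hω hβ₀ hm₀ hxs hys s
    have h2 : 0 ≤ 4 * ‖P.A‖ ^ 2 / ((innerCount ω m₀ s : ℝ) + 1) ^ 2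
        * halfSqDist xs (xtil (restartIndex ω m₀ (s + 1))) :=
      mul_nonneg (by positivity) (halfSqDist_nonneg _ _)
    linarith

/-! ### The rates -/

theorem smoothParam_le_rate (hω : 1 < ω) (hβ₀ : 0 < β₀) (hm₀ : 1 / (ω - 1) < (m₀ : ℝ)) (s : ℕ) :
    smoothParam ω β₀ m₀ s ≤ ω * β₀ * kappaZero ω m₀ / rateDenom ω m₀ s := by
  have h1 := (smoothParam_bounds hω hβ₀ hm₀ s).2
  have h2 := inv_pow_le_rate (m₀ := m₀) hω s
  have h3 : 0 < ω ^ s := by positivity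
  calc smoothParam ω β₀ m₀ s ≤ (ω ^ s)⁻¹ * β₀ := by rwa [le_inv_mul_iff₀ h3]
    _ ≤ ω * kappaZero ω m₀ / rateDenom ω m₀ s * β₀ := mul_le_mul_of_nonneg_right h2 hβ₀.le
    _ = _ := by ring

/-- Duality alone gives the lower bound, without any error term of order `1 / K`. -/
theorem IsDoubleLoopRun.objective_lower_bound (hP : P.StandingAssumptions)
    (hh : IsProxFunction h L) (hω : 1 < ω) (hβ₀ : 0 < β₀) (hm₀ : 1 / (ω - 1) < (m₀ : ℝ))
    (hrun : IsDoubleLoopRun P h ω β₀ m₀ x₀ y₀ xbar xtil ytil ydot tau)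
    (hxs : P.IsPrimalSolution xs) (hys : P.IsDualSolution ys) (s : ℕ) :
    -(‖ys‖ * Metric.infDist (P.A (xbar (restartIndex ω m₀ (s + 1))) - P.b) P.K)
      ≤ (P.f (xbar (restartIndex ω m₀ (s + 1)))).toReal - (P.f xs).toReal := by
  obtain ⟨hysD, hLag⟩ := hys.le_lagrangian hP hxs
  have h1 := hLag _ (hrun.stage_estimate hP hh hω hβ₀ hm₀ hxs hys s).1
  have h2 := inner_sub_supportFun_le hP.zero_mem hysD
    (P.A (xbar (restartIndex ω m₀ (s + 1))) - P.b)
  linarith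

/-- Testing the stage estimate with the multiplier `0`, at which `s_K` vanishes, removes the
smoothed penalty up to `β b_Y(0, ydot s)`. -/
theorem IsDoubleLoopRun.objective_upper_bound (hP : P.StandingAssumptions)
    (hh : IsProxFunction h L) (hω : 1 < ω) (hβ₀ : 0 < β₀) (hm₀ : 1 / (ω - 1) < (m₀ : ℝ))
    (hrun : IsDoubleLoopRun P h ω β₀ m₀ x₀ y₀ xbar xtil ytil ydot tau)
    (hxs : P.IsPrimalSolution xs) (hys : P.IsDualSolution ys) (s : ℕ) :
    (P.f (xbar (restartIndex ω m₀ (s + 1)))).toReal - (P.f xs).toReal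
      ≤ ω * kappaZero ω m₀ * RZero P h β₀ m₀ x₀ y₀ xs ys ^ 2 /
          (rhoZero ω β₀ m₀ * rateDenom ω m₀ s)
        + ω * β₀ * (L : ℝ) * kappaZero ω m₀ / (2 * rateDenom ω m₀ s) *
          (‖ys‖ + Real.sqrt 2 * RZero P h β₀ m₀ x₀ y₀ xs ys / rhoZero ω β₀ m₀) ^ 2 := by
  have hρ := rhoZero_pos hω hβ₀ hm₀
  have hβ := smoothParam_pos hω hβ₀ hm₀ s
  have hd := rateDenom_pos (m₀ := m₀) hω s
  have hws : 0 < ω ^ s := by positivity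
  have hE := hrun.stageEnergy_le hP hh hω hβ₀ hm₀ hxs hys s
  have hlow := (smoothParam_bounds hω hβ₀ hm₀ s).1
  have hβr := smoothParam_le_rate hω hβ₀ hm₀ s
  have hqr := inv_pow_le_rate (m₀ := m₀) hω s
  have hnorm := (hrun.norm_center_sub_le hP hh hω hβ₀ hm₀ hxs hys s).1
  have h1 := (hrun.stage_estimate hP hh hω hβ₀ hm₀ hxs hys s).2 0 zero_mem_effDomain_supportFun
  unfold smoothedLagrangian at h1
  rw [inner_zero_right] at h1
  set R := RZero P h β₀ m₀ x₀ y₀ xs ys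
  set β := smoothParam ω β₀ m₀ s
  set ρ := rhoZero ω β₀ m₀
  set E := stageEnergy P h ω β₀ m₀ xtil ydot xs ys s
  set F := (P.f (xbar (restartIndex ω m₀ (s + 1)))).toReal
  have hD : 0 ≤ 4 * ‖P.A‖ ^ 2 / ((innerCount ω m₀ s : ℝ) + 1) ^ 2
      * halfSqDist xs (xtil (restartIndex ω m₀ (s + 1))) :=
    mul_nonneg (by positivity) (halfSqDist_nonneg _ _)
  have hEβ : E / β ≤ (ω ^ s)⁻¹ * (R ^ 2 / ρ) := by
    have h2 : E ≤ R ^ 2 / (ω ^ s) ^ 2 := by rw [le_div_iff₀ (by positivity)]; linarith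
    have h3 : ρ / ω ^ s ≤ β := by rw [div_le_iff₀ hws]; linarith
    calc E / β ≤ R ^ 2 / (ω ^ s) ^ 2 / β := div_le_div_of_nonneg_right h2 hβ.le
      _ ≤ R ^ 2 / (ω ^ s) ^ 2 / (ρ / ω ^ s) :=
        div_le_div_of_nonneg_left (by positivity) (by positivity) h3
      _ = (ω ^ s)⁻¹ * (R ^ 2 / ρ) := by field_simp
  have hgap : F - (P.f xs).toReal ≤ E / β + β * bregman h 0 (ydot s) := by
    have h2 := toReal_supportFun_zero_le hP.zero_mem
    have h3 := mul_nonneg hβ.le (hh.bregman_nonneg ys (ydot s))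
    have h4 : F - (P.f xs).toReal - β * bregman h 0 (ydot s) ≤ E / β := by
      rw [le_div_iff₀ hβ]
      have h5 : F - (P.f xs).toReal - β * bregman h 0 (ydot s)
          ≤ F + (0 - (supportFun P.K 0).toReal - β * bregman h 0 (ydot s)) - (P.f xs).toReal
            + β * bregman h ys (ydot s) := by linarith
      have h6 := mul_le_mul_of_nonneg_left h5 hβ.le
      linarith
    linarith
  have hctr : ‖ydot s‖ ≤ ‖ys‖ + Real.sqrt 2 * R / ρ := by
    have h2 := norm_sub_le ys (ys - ydot s)
    rw [sub_sub_cancel] at h2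
    rw [mul_div_assoc]
    linarith
  have hb0 : bregman h 0 (ydot s) ≤ L / 2 * (‖ys‖ + Real.sqrt 2 * R / ρ) ^ 2 := by
    have h2 := hh.bregman_le 0 (ydot s)
    rw [zero_sub, norm_neg] at h2
    exact h2.trans (mul_le_mul_of_nonneg_left (pow_le_pow_left₀ (norm_nonneg _) hctr 2)
      (by positivity))
  have h5 : (ω ^ s)⁻¹ * (R ^ 2 / ρ) ≤ ω * kappaZero ω m₀ * R ^ 2 / (ρ * rateDenom ω m₀ s) :=
    (mul_le_mul_of_nonneg_right hqr (by positivity)).trans (le_of_eq (by field_simp))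
  have h6 : β * bregman h 0 (ydot s) ≤ ω * β₀ * (L : ℝ) * kappaZero ω m₀
      / (2 * rateDenom ω m₀ s) * (‖ys‖ + Real.sqrt 2 * R / ρ) ^ 2 := by
    calc β * bregman h 0 (ydot s) ≤ β * (L / 2 * (‖ys‖ + Real.sqrt 2 * R / ρ) ^ 2) :=
        mul_le_mul_of_nonneg_left hb0 hβ.le
      _ ≤ ω * β₀ * kappaZero ω m₀ / rateDenom ω m₀ s
          * (L / 2 * (‖ys‖ + Real.sqrt 2 * R / ρ) ^ 2) :=
        mul_le_mul_of_nonneg_right hβr (by positivity)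
      _ = _ := by field_simp
  linarith

/-- The optimality condition of the center step exhibits a point of `K` at distance
`β ‖∇h(ydot (s + 1)) - ∇h(ydot s)‖`, and both centers are near the dual solution. -/
theorem IsDoubleLoopRun.infDist_upper_bound (hP : P.StandingAssumptions)
    (hh : IsProxFunction h L) (hω : 1 < ω) (hβ₀ : 0 < β₀) (hm₀ : 1 / (ω - 1) < (m₀ : ℝ))
    (hrun : IsDoubleLoopRun P h ω β₀ m₀ x₀ y₀ xbar xtil ytil ydot tau)
    (hxs : P.IsPrimalSolution xs) (hys : P.IsDualSolution ys) (s : ℕ) :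
    Metric.infDist (P.A (xbar (restartIndex ω m₀ (s + 1))) - P.b) P.K
      ≤ ω * β₀ * (L : ℝ) * kappaZero ω m₀ / rateDenom ω m₀ s *
        (2 * ‖ys‖ + (2 * Real.sqrt 2 + Real.sqrt (2 / (L : ℝ))) *
          (RZero P h β₀ m₀ x₀ y₀ xs ys / rhoZero ω β₀ m₀)) := by
  have hρ := rhoZero_pos hω hβ₀ hm₀
  have hβ := smoothParam_pos hω hβ₀ hm₀ s
  have hβr := smoothParam_le_rate hω hβ₀ hm₀ s
  have hR : 0 ≤ RZero P h β₀ m₀ x₀ y₀ xs ys := Real.sqrt_nonneg _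
  obtain ⟨hn1, hn2⟩ := hrun.norm_center_sub_le hP hh hω hβ₀ hm₀ hxs hys s
  set r := RZero P h β₀ m₀ x₀ y₀ xs ys / rhoZero ω β₀ m₀
  have hr : 0 ≤ r := by positivity
  have h1 := (hrun.center_step s).infDist_le hP.zero_mem hP.set_closed hP.set_convex
    hh.differentiable hβ.le
  have h2 := hh.lipschitz_gradient.norm_sub_le (ydot (s + 1)) (ydot s)
  have h3 : ‖ydot (s + 1) - ydot s‖ ≤ 2 * Real.sqrt 2 * r := by
    have h4 := norm_sub_le (ys - ydot s) (ys - ydot (s + 1))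
    rw [sub_sub_sub_cancel_left] at h4
    linarith
  calc Metric.infDist (P.A (xbar (restartIndex ω m₀ (s + 1))) - P.b) P.K
      ≤ smoothParam ω β₀ m₀ s * (L * (2 * Real.sqrt 2 * r)) :=
        h1.trans (mul_le_mul_of_nonneg_left
          (h2.trans (mul_le_mul_of_nonneg_left h3 L.coe_nonneg)) hβ.le)
    _ ≤ ω * β₀ * kappaZero ω m₀ / rateDenom ω m₀ s * (L * (2 * Real.sqrt 2 * r)) :=
        mul_le_mul_of_nonneg_right hβr (by positivity)
    _ = ω * β₀ * (L : ℝ) * kappaZero ω m₀ / rateDenom ω m₀ s * (2 * Real.sqrt 2 * r) := by ring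
    _ ≤ _ := by
        have hκ := kappaZero_pos (m₀ := m₀) hω
        have hd := rateDenom_pos (m₀ := m₀) hω s
        refine mul_le_mul_of_nonneg_left ?_ (by positivity)
        have h5 : 0 ≤ Real.sqrt (2 / (L : ℝ)) * r := by positivity
        linarith [norm_nonneg ys]

end Run
theorem theorem2 {p n : ℕ} (P : ConstrainedProblem p n) (hP : P.StandingAssumptions)
    (h : Vec n → ℝ) (L : ℝ≥0) (hh : IsProxFunction h L)
    (ω β₀ : ℝ) (hω : 1 < ω) (hβ₀ : 0 < β₀) (m₀ : ℕ) (hm₀ : 1 / (ω - 1) < (m₀ : ℝ))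
    (x₀ : Vec p) (y₀ : Vec n)
    (xbar xtil : ℕ → Vec p) (ytil ydot : ℕ → Vec n) (tau : ℕ → ℝ)
    (hrun : IsDoubleLoopRun P h ω β₀ m₀ x₀ y₀ xbar xtil ytil ydot tau) :
    (∀ xs : Vec p, P.IsPrimalSolution xs → ∀ ys : Vec n, P.IsDualSolution ys → ∀ s : ℕ,
      ((-(‖ys‖ * Metric.infDist (P.A (xbar (restartIndex ω m₀ (s + 1))) - P.b) P.K)
          - 2 * Real.sqrt 2 * ω * β₀ * (L : ℝ) * kappaZero ω m₀ * ‖ys‖ *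
              RZero P h β₀ m₀ x₀ y₀ xs ys / (rhoZero ω β₀ m₀ * rateDenom ω m₀ s) : ℝ) : EReal)
        ≤ P.f (xbar (restartIndex ω m₀ (s + 1))) - P.optVal ∧
      P.f (xbar (restartIndex ω m₀ (s + 1))) - P.optVal
        ≤ ((ω * kappaZero ω m₀ * RZero P h β₀ m₀ x₀ y₀ xs ys ^ 2 /
              (rhoZero ω β₀ m₀ * rateDenom ω m₀ s)
            + ω * β₀ * (L : ℝ) * kappaZero ω m₀ / (2 * rateDenom ω m₀ s) *
              (‖ys‖ + Real.sqrt 2 * RZero P h β₀ m₀ x₀ y₀ xs ys / rhoZero ω β₀ m₀) ^ 2 : ℝ) :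
            EReal) ∧
      Metric.infDist (P.A (xbar (restartIndex ω m₀ (s + 1))) - P.b) P.K
        ≤ ω * β₀ * (L : ℝ) * kappaZero ω m₀ / rateDenom ω m₀ s *
          (2 * ‖ys‖ + (2 * Real.sqrt 2 + Real.sqrt (2 / (L : ℝ))) *
            (RZero P h β₀ m₀ x₀ y₀ xs ys / rhoZero ω β₀ m₀))) ∧
    ∃ C : ℝ, ∀ s : ℕ,
      ((-(C / (restartIndex ω m₀ (s + 1) : ℝ)) : ℝ) : EReal)
        ≤ P.f (xbar (restartIndex ω m₀ (s + 1))) - P.optVal ∧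
      P.f (xbar (restartIndex ω m₀ (s + 1))) - P.optVal
        ≤ ((C / (restartIndex ω m₀ (s + 1) : ℝ) : ℝ) : EReal) ∧
      Metric.infDist (P.A (xbar (restartIndex ω m₀ (s + 1))) - P.b) P.K
        ≤ C / (restartIndex ω m₀ (s + 1) : ℝ) := by
  have hvalue : ∀ xs : Vec p, P.IsPrimalSolution xs → ∀ ys : Vec n, P.IsDualSolution ys → ∀ s,
      P.f (xbar (restartIndex ω m₀ (s + 1))) - P.optVal
        = (((P.f (xbar (restartIndex ω m₀ (s + 1)))).toReal - (P.f xs).toReal : ℝ) : EReal) := by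
    intro xs hxs ys hys s
    rw [hxs.optVal_eq hP, EReal.coe_sub,
      hP.proper.coe_toReal (hrun.stage_estimate hP hh hω hβ₀ hm₀ hxs hys s).1]
  have hρ := rhoZero_pos hω hβ₀ hm₀
  have hκ := kappaZero_pos (m₀ := m₀) hω
  refine ⟨fun xs hxs ys hys s => ?_, ?_⟩
  · rw [hvalue xs hxs ys hys s, EReal.coe_le_coe_iff, EReal.coe_le_coe_iff]
    refine ⟨?_, hrun.objective_upper_bound hP hh hω hβ₀ hm₀ hxs hys s,
      hrun.infDist_upper_bound hP hh hω hβ₀ hm₀ hxs hys s⟩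
    have h1 := hrun.objective_lower_bound hP hh hω hβ₀ hm₀ hxs hys s
    have hd := rateDenom_pos (m₀ := m₀) hω s
    have hR : 0 ≤ RZero P h β₀ m₀ x₀ y₀ xs ys := Real.sqrt_nonneg _
    have h2 : 0 ≤ 2 * Real.sqrt 2 * ω * β₀ * (L : ℝ) * kappaZero ω m₀ * ‖ys‖ *
        RZero P h β₀ m₀ x₀ y₀ xs ys / (rhoZero ω β₀ m₀ * rateDenom ω m₀ s) := by positivity
    linarith
  · obtain ⟨xs, hxs⟩ := hP.exists_solution
    obtain ⟨ys, hys⟩ := ConstrainedProblem.exists_isDualSolution hP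
    have hR : 0 ≤ RZero P h β₀ m₀ x₀ y₀ xs ys := Real.sqrt_nonneg _
    set R := RZero P h β₀ m₀ x₀ y₀ xs ys with hRdef
    set ρ := rhoZero ω β₀ m₀
    set κ := kappaZero ω m₀
    set U := ω * κ * R ^ 2 / ρ + ω * β₀ * (L : ℝ) * κ / 2 * (‖ys‖ + Real.sqrt 2 * R / ρ) ^ 2
      with hU
    set T := ω * β₀ * (L : ℝ) * κ *
      (2 * ‖ys‖ + (2 * Real.sqrt 2 + Real.sqrt (2 / (L : ℝ))) * (R / ρ)) with hT
    have hU0 : 0 ≤ U := by positivity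
    have hT0 : 0 ≤ T := by positivity
    have hω1 : 0 < ω - 1 := by linarith
    refine ⟨(‖ys‖ * T + U + T) / (ω - 1), fun s => ?_⟩
    have hd := rateDenom_pos (m₀ := m₀) hω s
    have hK : 0 < (restartIndex ω m₀ (s + 1) : ℝ) := by
      have h1 := one_le_innerCount_of_lt hω hm₀ s
      rw [restartIndex, Nat.cast_add]
      have h2 : (0 : ℝ) ≤ restartIndex ω m₀ s := Nat.cast_nonneg _
      linarith
    have hrate : ∀ X : ℝ, 0 ≤ X → X ≤ ‖ys‖ * T + U + T → X / rateDenom ω m₀ s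
        ≤ (‖ys‖ * T + U + T) / (ω - 1) / (restartIndex ω m₀ (s + 1) : ℝ) := by
      intro X hX0 hX
      rw [div_div]
      refine div_le_div₀ (by positivity) hX (by positivity) ?_
      unfold rateDenom
      linarith
    have hyT : 0 ≤ ‖ys‖ * T := by positivity
    have hup := hrun.objective_upper_bound hP hh hω hβ₀ hm₀ hxs hys s
    have hlo := hrun.objective_lower_bound hP hh hω hβ₀ hm₀ hxs hys s
    have hdist : Metric.infDist (P.A (xbar (restartIndex ω m₀ (s + 1))) - P.b) P.K
        ≤ T / rateDenom ω m₀ s :=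
      (hrun.infDist_upper_bound hP hh hω hβ₀ hm₀ hxs hys s).trans
        (le_of_eq (by rw [hT, hRdef]; ring))
    rw [hvalue xs hxs ys hys s, EReal.coe_le_coe_iff, EReal.coe_le_coe_iff]
    refine ⟨?_, ?_, hdist.trans (hrate T hT0 (by linarith))⟩
    · have h1 := mul_le_mul_of_nonneg_left hdist (norm_nonneg ys)
      have h2 := hrate (‖ys‖ * T) hyT (by linarith)
      rw [mul_div_assoc] at h2
      linarith
    · refine (hup.trans (le_of_eq ?_)).trans (hrate U hU0 (by linarith))
      rw [hU, hRdef]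
      ring
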